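/- **Proposition 5.1.** All distributions are probability measures on $\mathbb R$ (those below live on $[0,\infty)$), $\overline F(x)=F((x,\infty))$, $F^{*k}$ is the $k$-fold convolution ($F^{*0}=\delta_0$), and all limits are for $x\to\infty$. Let $\gamma>0$. For non-lattice distributions with everywhere positive tail, $F\in\mathcal L(\gamma)$ means $\overline F(x-t)/\overline F(x)\to e^{\gamma t}$ for every real $t$; $F\in\mathcal{OL}$ means $\limsup\overline F(x-t)/\overline F(x)<\infty$ for every $t$; $F\in\mathcal{OS}$ means $\limsup\overline{F^{*2}}(x)/\overline F(x)<\infty$. Put $m(F)=\int_{[0,\infty)}e^{\gamma y}\,F(dy)\in[0,\infty]$. Let $\alpha\in[1/2,1)$, $r=1+1/\alpha$, $b\ge1$, $s\ge1$, and let $a>1$ satisfy $a^r>2^{s+2}a$. Put $a_n=a^{r^n}$ for $n\ge0$. Let $\eta$ be a random variable with $P(\eta=a_n)=Ca_n^{-\alpha}$, $n\ge 0$, where $C=(\sum_{n\ge0}a_n^{-\alpha})^{-1}$, let $U$ be uniform on $(0,1)$ and independent of $\eta$, and let $F_0$ be the distribution of $\eta(1+U^{1/b})^s$. Let $F$ be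 the distribution with tail $$\overline F(x)=\mathbf 1(x<0)+e^{-\gamma x}\,\overline{F_0}(x)\,\mathbf 1(x\ge0),\qquad x\in\mathbb R.$$ Then: 1. $\liminf\overline F(x-t)/\overline F(x)\ge e^{\gamma t}$ for all $t>0$; 2. $\overline F(x)=o\big(\overline{F^{*2}}(x)\big)$; 3. $m(F)=\infty$; 4. $F^{*k}\in\mathcal L(\gamma)\setminus\mathcal{OS}$ for all $k\ge2$; 5. $F\in\mathcal{OL}\setminus(\mathcal L(\gamma)\cup\mathcal{OS})$; 6. let $\tau$ be a random variable with values in $\{0,1,2,\dots\}$, $p_k=P(\tau=k)$, $P(\tau\ge2)>0$, and $F^{*\tau}=\sum_{k\ge0}p_kF^{*k}$. If for every $0<\varepsilon<1$ there is an integer $M\ge 0$ with $$\sum_{k=M}^\infty p_{k+1}\,\overline{F^{*k}}(x)\le\varepsilon\,\overline{F^{*\tau}}(x)\qquad\text{for all }x\ge0,$$ then $F^{*\tau}\in\mathcal L(\gamma)\setminus\mathcal{OS}$. -/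

import Mathlib

open MeasureTheory Set Filter Topology
open scoped ENNReal

namespace ConvRoots

/-- The tail `F̄(x) = F((x, ∞))` of a distribution `F` on the real line. -/
noncomputable def tail (F : Measure ℝ) (x : ℝ) : ℝ≥0∞ := F (Ioi x)

/-- The `k`-fold convolution `F^{*k}`, with `F^{*0}` the point mass at `0`. -/
noncomputable def convPow (F : Measure ℝ) : ℕ → Measure ℝ
  | 0 => Measure.dirac 0
  | k + 1 => Measure.conv F (convPow F k)

/-- The random convolution `F^{*τ} = ∑ₖ P(τ = k) F^{*k}`; the random variable `τ` with values in `ℕ`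
enters only through its law, a probability mass function. -/
noncomputable def randomConv (F : Measure ℝ) (τ : PMF ℕ) : Measure ℝ :=
  Measure.sum fun k => τ k • convPow F k

/-- `F` is a probability distribution all of whose tails are positive, so that ratios of tails make
sense at every point. -/
def HasPositiveTails (F : Measure ℝ) : Prop :=
  IsProbabilityMeasure F ∧ ∀ x, 0 < tail F x

/-- The class `𝓛(γ)`: `F̄(x - t) ∼ e^{γ t} F̄(x)` as `x → ∞`, for every real `t`. (This is the
definition for non-lattice distributions.) -/
def classL (γ : ℝ) : Set (Measure ℝ) :=
  {F | HasPositiveTails F ∧ ∀ t : ℝ,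
    Tendsto (fun x => tail F (x - t) / tail F x) atTop (𝓝 (ENNReal.ofReal (Real.exp (γ * t))))}

/-- The class `𝓞𝓛`: `limsup F̄(x - t) / F̄(x) < ∞` for every `t`. -/
def classOL : Set (Measure ℝ) :=
  {F | HasPositiveTails F ∧ ∀ t : ℝ, limsup (fun x => tail F (x - t) / tail F x) atTop < ∞}

/-- The class `𝓞𝓢`: `limsup (F^{*2})‾(x) / F̄(x) < ∞`. -/
def classOS : Set (Measure ℝ) :=
  {F | HasPositiveTails F ∧ limsup (fun x => tail (convPow F 2) x / tail F x) atTop < ∞}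

/-- The exponential moment `m(F) = ∫_{[0,∞)} e^{γ y} F(dy)`, possibly infinite. -/
noncomputable def expMoment (γ : ℝ) (F : Measure ℝ) : ℝ≥0∞ :=
  ∫⁻ y in Ici (0 : ℝ), ENNReal.ofReal (Real.exp (γ * y)) ∂F

/-- `liminf F̄(x - t) / F̄(x) ≥ e^{γ t}` for all `t > 0`. -/
def LiminfCondition (γ : ℝ) (F : Measure ℝ) : Prop :=
  ∀ t : ℝ, 0 < t →
    ENNReal.ofReal (Real.exp (γ * t)) ≤ liminf (fun x => tail F (x - t) / tail F x) atTop

/-- `F̄(x) = o((F^{*2})‾(x))` as `x → ∞`. -/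
def TailLittleO (F : Measure ℝ) : Prop :=
  Tendsto (fun x => tail F x / tail (convPow F 2) x) atTop (𝓝 0)

/-- For every `0 < ε < 1` there is an `M` such that
`∑_{k ≥ M} P(τ = k + 1) (F^{*k})‾(x) ≤ ε (F^{*τ})‾(x)` for all `x ≥ 0`. -/
def RandomSumCondition (F : Measure ℝ) (τ : PMF ℕ) : Prop :=
  ∀ ε : ℝ, 0 < ε → ε < 1 → ∃ M : ℕ, ∀ x : ℝ, 0 ≤ x →
    ∑' j : ℕ, τ (M + j + 1) * tail (convPow F (M + j)) x
      ≤ ENNReal.ofReal ε * tail (randomConv F τ) x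

/-- The sequence `a_n = a^{r^n}` with `r = 1 + 1/α`. -/
noncomputable def aSeq (α a : ℝ) (n : ℕ) : ℝ := a ^ ((1 + 1 / α) ^ n : ℝ)

/-- The law of `η`: `P(η = a_n) = C a_n^{-α}` with `C = (∑ₙ a_n^{-α})⁻¹`. -/
noncomputable def etaLaw (α a : ℝ) : Measure ℝ :=
  Measure.sum fun n =>
    ENNReal.ofReal ((∑' i, aSeq α a i ^ (-α))⁻¹ * aSeq α a n ^ (-α)) • Measure.dirac (aSeq α a n)

/-- The uniform law on `(0, 1)`. -/
noncomputable def unifLaw : Measure ℝ := volume.restrict (Ioo 0 1)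

/-- The law `F₀(α, a, b, s)` of `ξ = η (1 + U^{1/b})^s`, for `η` and `U` independent with the two
laws above. -/
noncomputable def xiLaw (α a b s : ℝ) : Measure ℝ :=
  Measure.map (fun p : ℝ × ℝ => p.1 * (1 + p.2 ^ (1 / b)) ^ s) ((etaLaw α a).prod unifLaw)

/-- The class `𝓕₁(0)` of the laws `F₀(α, a, b, s)` with `α ∈ [1/2, 1)`, `b ≥ 1`, `s ≥ 1`, `a > 1`
and `a^r > 2^{s+2} a`, where `r = 1 + 1/α`. -/
def classF1Zero : Set (Measure ℝ) :=
  {F₀ | ∃ α a b s : ℝ, 1 / 2 ≤ α ∧ α < 1 ∧ 1 ≤ b ∧ 1 ≤ s ∧ 1 < a ∧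
    2 ^ (s + 2) * a < a ^ (1 + 1 / α) ∧ F₀ = xiLaw α a b s}

/-- `F` is the exponential transform `F_γ` of `F₀`: the probability distribution with tail
`F̄(x) = 1(x < 0) + e^{-γ x} F̄₀(x) 1(x ≥ 0)`. It is determined by `F₀` and `γ`. -/
def IsExpTransform (γ : ℝ) (F₀ F : Measure ℝ) : Prop :=
  IsProbabilityMeasure F ∧ ∀ x : ℝ,
    tail F x = if x < 0 then 1 else ENNReal.ofReal (Real.exp (-γ * x)) * tail F₀ x

/-- The exponential transform of a distribution on `[0, ∞)` exists. -/
lemma exists_isExpTransform {γ : ℝ} (hγ : 0 < γ) (F₀ : Measure ℝ) [IsProbabilityMeasure F₀]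
    (h0 : F₀ (Iio 0) = 0) : ∃ F, IsExpTransform γ F₀ F := by
  have hp := ProbabilityTheory.isProbabilityMeasure_expMeasure hγ
  have hm : Measurable (fun p : ℝ × ℝ => min p.1 p.2) := measurable_fst.min measurable_snd
  refine ⟨(F₀.prod (ProbabilityTheory.expMeasure γ)).map (fun p => min p.1 p.2),
    Measure.isProbabilityMeasure_map hm.aemeasurable, fun x => ?_⟩
  have hpre : (fun p : ℝ × ℝ => min p.1 p.2) ⁻¹' (Ioi x) = Ioi x ×ˢ Ioi x := by
    ext p; simp
  have hE : (ProbabilityTheory.expMeasure γ) (Ioi x) = ENNReal.ofReal (1 - if 0 ≤ x then 1 - Real.exp (-(γ * x)) else 0) := by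
    have := ProbabilityTheory.cdf_expMeasure_eq hγ x
    rw [ProbabilityTheory.cdf_eq_real] at this
    rw [← compl_Iic, ← this, ← probReal_compl_eq_one_sub measurableSet_Iic]
    simp [Measure.real]
  rw [tail, Measure.map_apply hm measurableSet_Ioi, hpre, Measure.prod_prod, hE]
  split_ifs with h1 h2 h2
  · linarith
  · rw [mul_comm, tail]; simp
  · have : F₀ (Ioi x) = 1 := by
      rw [← compl_Iic, prob_compl_eq_one_iff measurableSet_Iic]
      exact measure_mono_null (fun y (hy : y ≤ x) => lt_of_le_of_lt hy h2) h0
    simp [this]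
  · linarith

/-- The class `𝓕₁(γ)` of the exponential transforms of the members of `𝓕₁(0)`. -/
def classF1 (γ : ℝ) : Set (Measure ℝ) :=
  {F | ∃ F₀ ∈ classF1Zero, IsExpTransform γ F₀ F}

end ConvRoots

open ConvRoots

namespace ConvRoots

/-! Write the tail of `F` on `[0, ∞)` as `e^{-γ x} G(x)`, where `G` is the tail of `η (1 +
U^{1/b})^s` (`mixTail`). Since `G` is nonincreasing, the liminf condition is immediate. The
exponential moment is infinite because `P(η = a_n) a_n → ∞` when `α < 1`. Fatou's lemma applied to
`∫ F̄(x - y) / F̄(x) F(dy)` then makes the tail of `F * F` infinitely larger than that of `F`; the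
same argument keeps every law with these two properties out of `𝓞𝓢`.

Membership in `𝓛(γ)` fails for `F` only near the points `β_n = 2^s a_n`. The exponent `r` gives `P(η
= a_{n+1}) = P(η = a_n) / a_n`, so the drop of `G` over a bounded interval just before `β_n` is
comparable with `G(β_n)` itself. Away from these points `G(x - t)` is close to `G(x)`, and after
`β_n` it is constant on a very long interval.

Convolution removes the defect. In `F̄^{*2}(x) = ∫ F̄(x - y) F(dy)`, the `y` with `x - y` within `K`
of `β_n` contribute at most a constant times `F̄(β_n) F̄(x - β_n)`, whereas a flat window of length
`L` after `β_n` contributes at least a constant times `L F̄(β_n) F̄(x - β_n)`. The windows are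
disjoint for large `n`, so large `L` makes the bad set negligible (`tail_convolution_near_negl`) and
`F * F` lies in `𝓛(γ)` (`upperShift_conv_self`). Further convolution, fixed or random, preserves the
shift bound up to errors absorbed by `F̄ = o(F̄^{*2})` or by the random sum condition. -/

/-- The weight `e^{γ t}` as an extended nonnegative real. -/
noncomputable def expWeight (γ t : ℝ) : ℝ≥0∞ := ENNReal.ofReal (Real.exp (γ * t))

lemma expWeight_ne_zero (γ t : ℝ) : expWeight γ t ≠ 0 := by
  simp [expWeight, Real.exp_pos]

lemma expWeight_ne_top (γ t : ℝ) : expWeight γ t ≠ ∞ := by simp [expWeight]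

lemma expWeight_add (γ s t : ℝ) : expWeight γ (s + t) = expWeight γ s * expWeight γ t := by
  rw [expWeight, expWeight, expWeight, ← ENNReal.ofReal_mul (Real.exp_pos _).le, ← Real.exp_add,
    mul_add]

@[simp] lemma expWeight_zero (γ : ℝ) : expWeight γ 0 = 1 := by simp [expWeight]

lemma expWeight_neg (γ t : ℝ) : expWeight γ (-t) = (expWeight γ t)⁻¹ := by
  apply ENNReal.eq_inv_of_mul_eq_one_left
  rw [← expWeight_add]; simp

lemma expWeight_mono {γ : ℝ} (hγ : 0 < γ) : Monotone (expWeight γ) := fun _ _ h =>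
  ENNReal.ofReal_le_ofReal (Real.exp_le_exp.2 (mul_le_mul_of_nonneg_left h hγ.le))

lemma measurable_expWeight (γ : ℝ) : Measurable (expWeight γ) := by
  unfold expWeight; fun_prop

lemma tail_antitone (F : Measure ℝ) : Antitone (tail F) := fun _ _ h =>
  measure_mono (Ioi_subset_Ioi h)

lemma tail_le_one (F : Measure ℝ) [IsProbabilityMeasure F] (x : ℝ) : tail F x ≤ 1 := prob_le_one

lemma tail_ne_top (F : Measure ℝ) [IsProbabilityMeasure F] (x : ℝ) : tail F x ≠ ∞ :=
  measure_ne_top _ _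

lemma measurable_tail_sub (F : Measure ℝ) (x : ℝ) : Measurable fun y => tail F (x - y) :=
  Monotone.measurable fun _ _ h => tail_antitone F (by linarith)

lemma tail_conv (F G : Measure ℝ) [SFinite F] [SFinite G] (x : ℝ) :
    tail (F.conv G) x = ∫⁻ y, tail F (x - y) ∂G := by
  rw [tail, Measure.conv, Measure.map_apply (by fun_prop) measurableSet_Ioi,
    Measure.prod_apply_symm (measurableSet_Ioi.preimage (by fun_prop))]
  congr 1 with y
  rw [tail]
  congr 1 with z
  simp [sub_lt_iff_lt_add]

/-! ### One-sided form of `𝓛(γ)` -/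

/-- A tail is asymptotically at most `c` times its shift, for every `c > e^{γ t}`. -/
def UpperShift (γ : ℝ) (V : Measure ℝ) : Prop :=
  ∀ t : ℝ, ∀ c, expWeight γ t < c → ∀ᶠ x in atTop, tail V (x - t) ≤ c * tail V x

/-- Upper bounds suffice because `t` ranges over all reals: the bound for `-t`, taken at the point
`x - t` and inverted, is the lower bound for `t`. -/
lemma UpperShift.mem_classL {γ : ℝ} {V : Measure ℝ} (h : UpperShift γ V)
    (hV : HasPositiveTails V) : V ∈ classL γ := by
  refine ⟨hV, fun t => ?_⟩
  have := hV.1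
  change Tendsto _ _ (𝓝 (expWeight γ t))
  refine tendsto_order.2 ⟨fun b hb => ?_, fun b hb => ?_⟩
  · have h1 : expWeight γ (-t) < b⁻¹ := by
      rw [expWeight_neg]; exact ENNReal.inv_lt_inv.2 hb
    obtain ⟨c, hc1, hc2⟩ := exists_between h1
    have := (tendsto_atTop_add_const_right atTop (-t) tendsto_id).eventually (h (-t) c hc1)
    filter_upwards [this] with x hx
    simp only [id, sub_neg_eq_add, ← sub_eq_add_neg, sub_add_cancel] at hx
    refine lt_of_lt_of_le (ENNReal.lt_inv_iff_lt_inv.1 hc2) ?_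
    rw [ENNReal.le_div_iff_mul_le (Or.inl (hV.2 x).ne') (Or.inl (tail_ne_top V x))]
    have hc0 : c ≠ 0 := (bot_lt_iff_ne_bot.1 (lt_of_le_of_lt bot_le hc1))
    have hct : c ≠ ∞ := (lt_of_lt_of_le hc2 le_top).ne
    calc c⁻¹ * tail V x ≤ c⁻¹ * (c * tail V (x - t)) := by gcongr
      _ = tail V (x - t) := by rw [← mul_assoc, ENNReal.inv_mul_cancel hc0 hct, one_mul]
  · obtain ⟨c, hc1, hc2⟩ := exists_between hb
    filter_upwards [h t c hc1] with x hx
    exact (ENNReal.div_le_of_le_mul hx).trans_lt hc2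

lemma upperShift_of_mem_classL {γ : ℝ} {V : Measure ℝ} (h : V ∈ classL γ) : UpperShift γ V := by
  intro t c hc
  have := h.1.1
  filter_upwards [(tendsto_order.1 (h.2 t)).2 c hc] with x hx
  rw [← ENNReal.div_le_iff_le_mul (Or.inl (h.1.2 x).ne') (Or.inl (tail_ne_top V x))]
  exact hx.le

lemma liminfCondition_of_mem_classL {γ : ℝ} {V : Measure ℝ} (h : V ∈ classL γ) :
    LiminfCondition γ V := fun t _ => (h.2 t).liminf_eq.ge

lemma convPow_two (V : Measure ℝ) [SFinite V] : convPow V 2 = V.conv V := by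
  simp [convPow]

/-! ### Infinite exponential moment and the self-convolution -/

/-- Fatou's lemma: the ratio is the integral of `F̄(x - y) / F̄(x)`, whose liminf dominates `e^{γ
y}` for `y ≥ 0`. -/
lemma liminf_tail_conv_self_div {γ : ℝ} {V : Measure ℝ} (hV : HasPositiveTails V)
    (h : LiminfCondition γ V) (hm : expMoment γ V = ∞) :
    liminf (fun x => tail (convPow V 2) x / tail V x) atTop = ∞ := by
  have := hV.1
  have h0 : ∀ x, tail (convPow V 2) x / tail V x = ∫⁻ y, tail V (x - y) / tail V x ∂V := by
    intro x
    simp_rw [div_eq_mul_inv]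
    rw [lintegral_mul_const _ (measurable_tail_sub V x), convPow_two, tail_conv]
  simp_rw [h0]
  refine top_le_iff.1 (le_trans ?_ (lintegral_liminf_le
    fun x => (measurable_tail_sub V x).div_const _))
  rw [← hm, expMoment]
  refine (setLIntegral_mono' measurableSet_Ici fun y hy => ?_).trans (setLIntegral_le_lintegral _ _)
  rcases (mem_Ici.1 hy).eq_or_lt with rfl | hy
  · simp [ENNReal.div_self (hV.2 _).ne' (tail_ne_top V _)]
  · exact h y hy

lemma tendsto_tail_conv_self_div {γ : ℝ} {V : Measure ℝ} (hV : HasPositiveTails V)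
    (h : LiminfCondition γ V) (hm : expMoment γ V = ∞) :
    Tendsto (fun x => tail (convPow V 2) x / tail V x) atTop (𝓝 ∞) :=
  tendsto_of_le_liminf_of_limsup_le (liminf_tail_conv_self_div hV h hm).ge le_top

lemma tailLittleO_of_expMoment {γ : ℝ} {V : Measure ℝ} (hV : HasPositiveTails V)
    (h : LiminfCondition γ V) (hm : expMoment γ V = ∞) : TailLittleO V := by
  have := hV.1
  have := tendsto_inv_iff.2 (tendsto_tail_conv_self_div hV h hm)
  rw [ENNReal.inv_top] at this
  refine this.congr fun x => ?_
  rw [ENNReal.inv_div (Or.inl (tail_ne_top V x)) (Or.inl (hV.2 x).ne')]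

lemma notMem_classOS {γ : ℝ} {V : Measure ℝ} (hV : HasPositiveTails V)
    (h : LiminfCondition γ V) (hm : expMoment γ V = ∞) : V ∉ classOS := fun hOS => by
  have := hOS.2
  rw [(tendsto_tail_conv_self_div hV h hm).limsup_eq] at this
  exact lt_irrefl _ this

/-! ### Shift bounds under convolution -/

/-- `Q = o(V)` for nonnegative functions. -/
def Negl (Q V : ℝ → ℝ≥0∞) : Prop :=
  ∀ ε : ℝ≥0∞, ε ≠ 0 → ∀ᶠ x in atTop, Q x ≤ ε * V x

lemma Negl.mono_right {Q V W : ℝ → ℝ≥0∞} (h : Negl Q V) (hVW : ∀ x, V x ≤ W x) : Negl Q W :=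
  fun ε hε => (h ε hε).mono fun x hx => hx.trans (by gcongr; exact hVW x)

lemma Negl.of_le_mul {P Q V : ℝ → ℝ≥0∞} (h : Negl Q V) {c : ℝ≥0∞} (hc : c ≠ ∞)
    (hPQ : ∀ x, P x ≤ c * Q x) : Negl P V := by
  intro ε hε
  rcases eq_or_ne c 0 with rfl | hc0
  · exact Eventually.of_forall fun x => (hPQ x).trans (by simp)
  · filter_upwards [h (ε / c) (ENNReal.div_pos hε hc).ne'] with x hx
    calc P x ≤ c * Q x := hPQ x
      _ ≤ c * (ε / c * V x) := by gcongr
      _ = ε * V x := by rw [← mul_assoc, ENNReal.mul_div_cancel hc0 hc]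

lemma TailLittleO.negl {V : Measure ℝ} [IsProbabilityMeasure V] (h : TailLittleO V) :
    Negl (tail V) (tail (V.conv V)) := by
  intro ε hε
  rw [TailLittleO, convPow_two] at h
  filter_upwards [(tendsto_order.1 h).2 ε (pos_iff_ne_zero.2 hε)] with x hx
  by_cases h0 : tail (V.conv V) x = 0
  · by_cases h1 : tail V x = 0
    · simp [h1]
    · rw [h0, ENNReal.div_zero h1] at hx
      exact absurd hx not_top_lt
  · rw [← ENNReal.div_le_iff_le_mul (Or.inl h0) (Or.inl (tail_ne_top _ _))]
    exact hx.le

/-- For `y ≤ x - A` the assumed bound applies at `x - y ≥ A`; for `y > x - A` the tail is at most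
`1`, which costs the mass that `Q` puts there. -/
lemma tail_conv_shift_le_add {V : Measure ℝ} [IsProbabilityMeasure V] {t A : ℝ} {c : ℝ≥0∞}
    (h : ∀ u, A ≤ u → tail V (u - t) ≤ c * tail V u) (Q : Measure ℝ) [IsProbabilityMeasure Q]
    (x : ℝ) :
    tail (V.conv Q) (x - t) ≤ c * tail (V.conv Q) x + tail Q (x - A) := by
  rw [tail_conv, tail_conv, ← lintegral_const_mul _ (measurable_tail_sub V x), tail,
    ← lintegral_indicator_one measurableSet_Ioi,
    ← lintegral_add_left ((measurable_tail_sub V x).const_mul c)]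
  refine lintegral_mono fun y => ?_
  by_cases hy : y ∈ Ioi (x - A)
  · simp only [indicator_of_mem hy, Pi.one_apply]
    exact (tail_le_one V _).trans le_add_self
  · simp only [indicator_of_notMem hy, add_zero]
    have := h (x - y) (by simp at hy; linarith)
    rwa [show x - t - y = x - y - t by ring]

lemma tail_conv_shift_le {V : Measure ℝ} [IsProbabilityMeasure V] {t : ℝ} {c : ℝ≥0∞}
    (h : ∀ u, tail V (u - t) ≤ c * tail V u) (Q : Measure ℝ) [IsProbabilityMeasure Q]
    (x : ℝ) : tail (V.conv Q) (x - t) ≤ c * tail (V.conv Q) x := by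
  rw [tail_conv, tail_conv, ← lintegral_const_mul _ (measurable_tail_sub V x)]
  refine lintegral_mono fun y => ?_
  have := h (x - y)
  rwa [show x - t - y = x - y - t by ring]

lemma eventually_tail_conv_shift_le {V Q : Measure ℝ} [IsProbabilityMeasure V]
    [IsProbabilityMeasure Q] {t : ℝ} {c c' : ℝ≥0∞} (hc : c < c')
    (h : ∀ᶠ u in atTop, tail V (u - t) ≤ c * tail V u)
    (hQ : ∀ A, Negl (fun x => tail Q (x - A)) (tail (V.conv Q))) :
    ∀ᶠ x in atTop, tail (V.conv Q) (x - t) ≤ c' * tail (V.conv Q) x := by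
  obtain ⟨r, hr, hcr⟩ := ENNReal.lt_iff_exists_add_pos_lt.1 hc
  obtain ⟨A, hA⟩ := eventually_atTop.1 h
  filter_upwards [hQ A r (by exact_mod_cast hr.ne')] with x hx
  calc _ ≤ c * tail (V.conv Q) x + tail Q (x - A) := tail_conv_shift_le_add hA Q x
    _ ≤ c * tail (V.conv Q) x + r * tail (V.conv Q) x := by gcongr
    _ = (c + r) * tail (V.conv Q) x := by ring
    _ ≤ _ := by gcongr

lemma UpperShift.conv {γ : ℝ} {V Q : Measure ℝ} [IsProbabilityMeasure V]
    [IsProbabilityMeasure Q] (h : UpperShift γ V)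
    (hQ : ∀ A, Negl (fun x => tail Q (x - A)) (tail (V.conv Q))) : UpperShift γ (V.conv Q) := by
  intro t c hc
  obtain ⟨c₁, h1, h2⟩ := exists_between hc
  exact eventually_tail_conv_shift_le h2 (h t c₁ h1) hQ

/-! ### Convolution powers -/

instance isProbabilityMeasure_convPow (F : Measure ℝ) [IsProbabilityMeasure F] (k : ℕ) :
    IsProbabilityMeasure (convPow F k) := by
  induction k with
  | zero => rw [convPow]; infer_instance
  | succ k ih => rw [convPow]; infer_instance

lemma ae_nonneg_of_Iio {F : Measure ℝ} (h0 : F (Iio 0) = 0) : ∀ᵐ y ∂F, 0 ≤ y := by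
  rw [ae_iff]; convert h0 using 2; ext y; simp

lemma tail_le_tail_conv {F : Measure ℝ} [IsProbabilityMeasure F] (h0 : F (Iio 0) = 0)
    (V : Measure ℝ) [IsProbabilityMeasure V] (x : ℝ) : tail V x ≤ tail (V.conv F) x := by
  rw [tail_conv]
  calc tail V x = ∫⁻ _, tail V x ∂F := by simp
    _ ≤ _ := lintegral_mono_ae <| (ae_nonneg_of_Iio h0).mono fun y hy =>
      tail_antitone V (by linarith)

lemma convPow_succ' (F : Measure ℝ) [IsProbabilityMeasure F] (k : ℕ) :
    convPow F (k + 1) = (convPow F k).conv F := by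
  rw [convPow, Measure.conv_comm]

lemma convPow_one (F : Measure ℝ) [IsProbabilityMeasure F] : convPow F 1 = F := by
  simp [convPow]

lemma convPow_add_two (F : Measure ℝ) [IsProbabilityMeasure F] (k : ℕ) :
    convPow F (k + 2) = (F.conv F).conv (convPow F k) := by
  rw [Measure.conv_assoc, convPow, convPow]

lemma tail_convPow_mono {F : Measure ℝ} [IsProbabilityMeasure F] (h0 : F (Iio 0) = 0) (x : ℝ) :
    Monotone fun k => tail (convPow F k) x :=
  monotone_nat_of_le_succ fun k => by
    rw [convPow_succ']
    exact tail_le_tail_conv h0 _ x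

lemma expMoment_eq_lintegral_indicator (γ : ℝ) (V : Measure ℝ) :
    expMoment γ V = ∫⁻ y, (Ici (0 : ℝ)).indicator (expWeight γ) y ∂V := by
  rw [lintegral_indicator measurableSet_Ici]; rfl

lemma expMoment_le_expMoment_conv {γ : ℝ} (hγ : 0 < γ) {F : Measure ℝ} [IsProbabilityMeasure F]
    (h0 : F (Iio 0) = 0) (V : Measure ℝ) [IsProbabilityMeasure V] :
    expMoment γ V ≤ expMoment γ (V.conv F) := by
  rw [expMoment_eq_lintegral_indicator, expMoment_eq_lintegral_indicator,
    Measure.lintegral_conv ((measurable_expWeight γ).indicator measurableSet_Ici)]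
  refine lintegral_mono fun x => ?_
  calc (Ici (0 : ℝ)).indicator (expWeight γ) x
      = ∫⁻ _, (Ici (0 : ℝ)).indicator (expWeight γ) x ∂F := by simp
    _ ≤ _ := lintegral_mono_ae <| (ae_nonneg_of_Iio h0).mono fun y hy => ?_
  refine indicator_apply_le' (fun hx => ?_) fun _ => zero_le
  rw [mem_Ici] at hx
  rw [indicator_of_mem (mem_Ici.2 (add_nonneg hx hy))]
  exact expWeight_mono hγ (by linarith)

lemma expMoment_convPow {γ : ℝ} (hγ : 0 < γ) {F : Measure ℝ} [IsProbabilityMeasure F]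
    (h0 : F (Iio 0) = 0) (hm : expMoment γ F = ∞) {k : ℕ} (hk : 1 ≤ k) :
    expMoment γ (convPow F k) = ∞ := by
  induction k, hk using Nat.le_induction with
  | base => rwa [convPow_one]
  | succ k _ ih =>
    rw [convPow_succ', ← top_le_iff, ← ih]
    exact expMoment_le_expMoment_conv hγ h0 _

lemma hasPositiveTails_convPow {F : Measure ℝ} (hF : HasPositiveTails F) (h0 : F (Iio 0) = 0)
    {k : ℕ} (hk : 1 ≤ k) : HasPositiveTails (convPow F k) := by
  have := hF.1
  refine ⟨inferInstance, fun x => (hF.2 x).trans_le ?_⟩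
  simpa [convPow_one] using tail_convPow_mono h0 x hk

lemma tail_conv_self_le_convPow {F : Measure ℝ} [IsProbabilityMeasure F] (h0 : F (Iio 0) = 0)
    {k : ℕ} (hk : 2 ≤ k) (x : ℝ) : tail (F.conv F) x ≤ tail (convPow F k) x := by
  rw [← convPow_two]
  exact tail_convPow_mono h0 x hk

/-- The tail of `F` is dominated, up to a constant, by each of its shifts. -/
def ShiftDominated (F : Measure ℝ) : Prop :=
  ∀ t : ℝ, ∃ c : ℝ≥0∞, c ≠ ∞ ∧ ∀ u, tail F (u - t) ≤ c * tail F u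

/-- Convolving once more with `F` produces an error `F̄(x - A)`. Shift domination bounds it by a
multiple of `F̄(x)`, which is negligible against `F̄^{*2}(x)` and hence against every higher power.
-/
lemma upperShift_convPow {γ : ℝ} {F : Measure ℝ} [IsProbabilityMeasure F] (h0 : F (Iio 0) = 0)
    (hs : ShiftDominated F) (hN : Negl (tail F) (tail (F.conv F)))
    (h2 : UpperShift γ (F.conv F)) {k : ℕ} (hk : 2 ≤ k) : UpperShift γ (convPow F k) := by
  induction k, hk using Nat.le_induction with
  | base => rwa [convPow_two]
  | succ k hk ih =>
    rw [convPow_succ']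
    refine ih.conv fun A => ?_
    obtain ⟨c, hc, hA⟩ := hs A
    refine (hN.mono_right fun x => ?_).of_le_mul hc hA
    rw [← convPow_succ']
    exact tail_conv_self_le_convPow h0 (by omega) x

lemma convPow_mem_classL_diff_classOS {γ : ℝ} (hγ : 0 < γ) {F : Measure ℝ}
    (hF : HasPositiveTails F) (h0 : F (Iio 0) = 0) (hs : ShiftDominated F)
    (hN : Negl (tail F) (tail (F.conv F))) (hm : expMoment γ F = ∞)
    (h2 : UpperShift γ (F.conv F)) {k : ℕ} (hk : 2 ≤ k) :
    convPow F k ∈ classL γ \ classOS := by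
  have := hF.1
  have hp := hasPositiveTails_convPow hF h0 (k := k) (by omega)
  have hL := (upperShift_convPow h0 hs hN h2 hk).mem_classL hp
  exact ⟨hL, notMem_classOS hp (liminfCondition_of_mem_classL hL)
    (expMoment_convPow hγ h0 hm (by omega))⟩

/-! ### Random convolutions -/

lemma tail_randomConv (F : Measure ℝ) (τ : PMF ℕ) (x : ℝ) :
    tail (randomConv F τ) x = ∑' k, τ k * tail (convPow F k) x := by
  rw [tail, randomConv, Measure.sum_apply _ measurableSet_Ioi]
  simp [tail]

lemma isProbabilityMeasure_randomConv (F : Measure ℝ) [IsProbabilityMeasure F] (τ : PMF ℕ) :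
    IsProbabilityMeasure (randomConv F τ) := by
  constructor
  rw [randomConv, Measure.sum_apply _ MeasurableSet.univ]
  simp

lemma mul_tail_convPow_le_randomConv (F : Measure ℝ) (τ : PMF ℕ) (k : ℕ) (x : ℝ) :
    τ k * tail (convPow F k) x ≤ tail (randomConv F τ) x := by
  rw [tail_randomConv]
  exact ENNReal.le_tsum k

lemma tail_convPow_zero {F : Measure ℝ} {x : ℝ} (hx : 0 ≤ x) : tail (convPow F 0) x = 0 := by
  simp [tail, convPow, hx]

lemma tail_randomConv_shift_le {F : Measure ℝ} [IsProbabilityMeasure F] {t : ℝ} {c : ℝ≥0∞}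
    (h : ∀ u, tail F (u - t) ≤ c * tail F u) (τ : PMF ℕ) {x : ℝ} (hx : t ≤ x) :
    tail (randomConv F τ) (x - t) ≤ c * tail (randomConv F τ) x := by
  rw [tail_randomConv, tail_randomConv, ← ENNReal.tsum_mul_left]
  refine ENNReal.tsum_le_tsum fun k => ?_
  rw [mul_left_comm]
  gcongr
  cases k with
  | zero => simp [tail_convPow_zero (sub_nonneg.2 hx)]
  | succ k => rw [convPow]; exact tail_conv_shift_le h _ x

/-- Dropping the first term of the series allows indices starting at `M + 2`, so that two factors
`F` can be split off each convolution power. Taking the minimum with `1` removes the restriction `ε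
< 1`. -/
lemma RandomSumCondition.exists_succ {F : Measure ℝ} {τ : PMF ℕ} (h : RandomSumCondition F τ)
    {ε : ℝ≥0∞} (hε : ε ≠ 0) : ∃ M : ℕ, ∀ x : ℝ, 0 ≤ x →
      ∑' j : ℕ, τ (j + (M + 2)) * tail (convPow F (j + (M + 1))) x
        ≤ ε * tail (randomConv F τ) x := by
  obtain ⟨e, he0, he⟩ := ENNReal.lt_iff_exists_nnreal_btwn.1
    (lt_min (pos_iff_ne_zero.2 hε) one_pos)
  obtain ⟨he1, he2⟩ := lt_min_iff.1 he
  obtain ⟨M, hM⟩ := h e (by exact_mod_cast he0) (by exact_mod_cast he2)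
  refine ⟨M, fun x hx => ?_⟩
  calc _ ≤ ∑' j : ℕ, τ (M + j + 1) * tail (convPow F (M + j)) x := by
        have := ENNReal.tsum_comp_le_tsum_of_injective (add_left_injective 1)
          fun j : ℕ => τ (M + j + 1) * tail (convPow F (M + j)) x
        refine le_trans (le_of_eq ?_) this
        congr 1 with j
        rw [show j + (M + 2) = M + (j + 1) + 1 by omega, show j + (M + 1) = M + (j + 1) by omega]
    _ ≤ _ := hM x hx
    _ ≤ _ := by rw [ENNReal.ofReal_coe_nnreal]; gcongr

/-- Finitely many summands are handled one by one. In the rest the shift bound must be uniform in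
`k`: it is applied only to the factor `F * F`, and the resulting errors add up to the series in the
random sum condition. -/
lemma upperShift_randomConv {γ : ℝ} {F : Measure ℝ} [IsProbabilityMeasure F]
    (h0 : F (Iio 0) = 0) (hs : ShiftDominated F) (hN : Negl (tail F) (tail (F.conv F)))
    (h2 : UpperShift γ (F.conv F)) {τ : PMF ℕ} (hτ : ∃ k, 2 ≤ k ∧ τ k ≠ 0)
    (hc : RandomSumCondition F τ) : UpperShift γ (randomConv F τ) := by
  intro t c htc
  obtain ⟨c₁, hc₁, h1⟩ := exists_between htc
  obtain ⟨r, hr, hcr⟩ := ENNReal.lt_iff_exists_add_pos_lt.1 h1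
  have hr2 : (r : ℝ≥0∞) / 2 ≠ 0 := (ENNReal.half_pos (by exact_mod_cast hr.ne')).ne'
  obtain ⟨A, hA⟩ := eventually_atTop.1 (h2 t c₁ hc₁)
  obtain ⟨C, hC, hCA⟩ := hs A
  obtain ⟨D, hD, hDt⟩ := hs t
  obtain ⟨M, hM⟩ := hc.exists_succ (ENNReal.div_pos hr2 hC).ne'
  have hNW : Negl (tail F) (tail (randomConv F τ)) := by
    obtain ⟨k, hk, hk0⟩ := hτ
    intro ε hε
    filter_upwards [hN (ε * τ k) (mul_ne_zero hε hk0)] with x hx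
    calc tail F x ≤ ε * τ k * tail (F.conv F) x := hx
      _ ≤ ε * τ k * tail (convPow F k) x := by gcongr; exact tail_conv_self_le_convPow h0 hk x
      _ ≤ _ := by rw [mul_assoc]; gcongr; exact mul_tail_convPow_le_randomConv F τ k x
  set W := tail (randomConv F τ) with hW
  -- The `M + 2` head terms share the error budget `r / 2`; the remaining series uses the other
  -- half.
  have hδ : (r : ℝ≥0∞) / 2 / ((M + 2 : ℕ) : ℝ≥0∞) ≠ 0 :=
    (ENNReal.div_pos hr2 (ENNReal.natCast_ne_top _)).ne'
  have hhead : ∀ᶠ x in atTop, ∀ k ∈ Finset.range (M + 2),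
      τ k * tail (convPow F k) (x - t) ≤ c₁ * (τ k * tail (convPow F k) x)
        + r / 2 / ((M + 2 : ℕ) : ℝ≥0∞) * W x := by
    rw [eventually_all_finset]
    intro k _
    rcases lt_or_ge k 2 with hk | hk
    · interval_cases k
      · filter_upwards [eventually_ge_atTop t] with x hx
        simp [tail_convPow_zero (sub_nonneg.2 hx)]
      · filter_upwards [hNW.of_le_mul hD hDt _ hδ] with x hx
        rw [convPow_one]
        calc τ 1 * tail F (x - t) ≤ 1 * tail F (x - t) := by gcongr; exact τ.coe_le_one 1
          _ ≤ _ := by rw [one_mul]; exact hx.trans le_add_self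
    · filter_upwards [upperShift_convPow h0 hs hN h2 hk t c₁ hc₁] with x hx
      rw [mul_left_comm]
      exact le_trans (by gcongr) le_self_add
  filter_upwards [hhead, eventually_ge_atTop A] with x hx hxA
  have htl : ∑' j : ℕ, τ (j + (M + 2)) * tail (convPow F (j + (M + 2))) (x - t)
      ≤ c₁ * ∑' j : ℕ, τ (j + (M + 2)) * tail (convPow F (j + (M + 2))) x + r / 2 * W x := by
    calc _ ≤ ∑' j : ℕ, (c₁ * (τ (j + (M + 2)) * tail (convPow F (j + (M + 2))) x)
          + τ (j + (M + 2)) * tail (convPow F (j + (M + 1))) (x - A)) := by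
          refine ENNReal.tsum_le_tsum fun j => ?_
          rw [mul_left_comm, ← mul_add]
          gcongr
          rw [← add_assoc j M 2, convPow_add_two]
          refine (tail_conv_shift_le_add hA _ x).trans ?_
          gcongr
          exact tail_convPow_mono h0 _ (by omega)
      _ = c₁ * ∑' j : ℕ, τ (j + (M + 2)) * tail (convPow F (j + (M + 2))) x +
          ∑' j : ℕ, τ (j + (M + 2)) * tail (convPow F (j + (M + 1))) (x - A) := by
          rw [ENNReal.tsum_add, ENNReal.tsum_mul_left]
      _ ≤ _ := by
          gcongr
          -- The condition is used at `x - A`; returning to `x` costs the factor `C`, which the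
          -- choice of `M` has already divided out.
          calc _ ≤ r / 2 / C * W (x - A) := hM _ (sub_nonneg.2 hxA)
            _ ≤ r / 2 / C * (C * W x) := by gcongr; exact tail_randomConv_shift_le hCA τ hxA
            _ ≤ _ := by
              rw [← mul_assoc, mul_comm (_ / C)]; gcongr; exact ENNReal.mul_div_le
  have hhd : ∑ k ∈ Finset.range (M + 2), τ k * tail (convPow F k) (x - t)
      ≤ c₁ * ∑ k ∈ Finset.range (M + 2), τ k * tail (convPow F k) x + r / 2 * W x := by
    refine (Finset.sum_le_sum hx).trans ?_
    rw [Finset.sum_add_distrib, ← Finset.mul_sum, Finset.sum_const, Finset.card_range,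
      nsmul_eq_mul, ← mul_assoc]
    gcongr
    exact ENNReal.mul_div_le
  have hsplit : ∀ y, W y = ∑ k ∈ Finset.range (M + 2), τ k * tail (convPow F k) y
      + ∑' j : ℕ, τ (j + (M + 2)) * tail (convPow F (j + (M + 2))) y := fun y => by
    rw [hW, tail_randomConv]
    exact (ENNReal.summable.sum_add_tsum_nat_add' (f := fun k => τ k * tail (convPow F k) y)
      (k := M + 2)).symm
  calc W (x - t)
      ≤ (c₁ * ∑ k ∈ Finset.range (M + 2), τ k * tail (convPow F k) x + r / 2 * W x)
        + (c₁ * ∑' j : ℕ, τ (j + (M + 2)) * tail (convPow F (j + (M + 2))) x + r / 2 * W x) := by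
        rw [hsplit]; exact add_le_add hhd htl
    _ = c₁ * (∑ k ∈ Finset.range (M + 2), τ k * tail (convPow F k) x
        + ∑' j : ℕ, τ (j + (M + 2)) * tail (convPow F (j + (M + 2))) x)
        + (r / 2 + r / 2) * W x := by ring
    _ = (c₁ + r) * W x := by rw [← hsplit, ENNReal.add_halves, add_mul]
    _ ≤ _ := by gcongr

lemma expMoment_randomConv {γ : ℝ} (hγ : 0 < γ) {F : Measure ℝ} [IsProbabilityMeasure F]
    (h0 : F (Iio 0) = 0) (hm : expMoment γ F = ∞) {τ : PMF ℕ} (hτ : ∃ k, 2 ≤ k ∧ τ k ≠ 0) :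
    expMoment γ (randomConv F τ) = ∞ := by
  obtain ⟨k, hk, hk0⟩ := hτ
  have hle : τ k • convPow F k ≤ randomConv F τ := Measure.le_sum (fun k => τ k • convPow F k) k
  rw [← top_le_iff]
  calc ∞ = τ k * expMoment γ (convPow F k) := by
        rw [expMoment_convPow hγ h0 hm (by omega), ENNReal.mul_top hk0]
    _ = expMoment γ (τ k • convPow F k) := by
        rw [expMoment_eq_lintegral_indicator, expMoment_eq_lintegral_indicator,
          lintegral_smul_measure, smul_eq_mul]
    _ ≤ _ := by
        rw [expMoment_eq_lintegral_indicator, expMoment_eq_lintegral_indicator]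
        exact lintegral_mono' hle le_rfl

lemma randomConv_mem_classL_diff_classOS {γ : ℝ} (hγ : 0 < γ) {F : Measure ℝ}
    (hF : HasPositiveTails F) (h0 : F (Iio 0) = 0) (hs : ShiftDominated F)
    (hN : Negl (tail F) (tail (F.conv F))) (hm : expMoment γ F = ∞)
    (h2 : UpperShift γ (F.conv F)) {τ : PMF ℕ} (hτ : ∃ k, 2 ≤ k ∧ τ k ≠ 0)
    (hc : RandomSumCondition F τ) : randomConv F τ ∈ classL γ \ classOS := by
  have := hF.1
  have hp : HasPositiveTails (randomConv F τ) := by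
    refine ⟨isProbabilityMeasure_randomConv F τ, fun x => ?_⟩
    obtain ⟨k, hk, hk0⟩ := hτ
    exact (ENNReal.mul_pos hk0 ((hasPositiveTails_convPow hF h0 (k := k) (by omega)).2 x).ne').trans_le
      (mul_tail_convPow_le_randomConv F τ k x)
  have hL := (upperShift_randomConv h0 hs hN h2 hτ hc).mem_classL hp
  exact ⟨hL, notMem_classOS hp (liminfCondition_of_mem_classL hL)
    (expMoment_randomConv hγ h0 hm hτ)⟩

/-! ### Exponentially tilted tails -/

/-- `e^{γ x} F̄(x)` is nonincreasing on `[0, ∞)`. -/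
def ExpTilted (γ : ℝ) (F : Measure ℝ) : Prop :=
  ∀ t u : ℝ, 0 ≤ t → t ≤ u → expWeight γ t * tail F u ≤ tail F (u - t)

lemma ExpTilted.liminfCondition {γ : ℝ} {F : Measure ℝ} (h : ExpTilted γ F)
    (hF : HasPositiveTails F) : LiminfCondition γ F := by
  have := hF.1
  intro t ht
  refine le_liminf_of_le (by isBoundedDefault) ?_
  filter_upwards [eventually_ge_atTop t] with x hx
  rw [ENNReal.le_div_iff_mul_le (Or.inl (hF.2 x).ne') (Or.inl (tail_ne_top F x))]
  exact h t x ht.le hx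

lemma ExpTilted.mul_tail_le_measure_Ioc {γ : ℝ} {F : Measure ℝ} [IsProbabilityMeasure F]
    (h : ExpTilted γ F) {u : ℝ} (hu : 1 ≤ u) :
    (1 - expWeight γ (-1)) * tail F (u - 1) ≤ F (Ioc (u - 1) u) := by
  have h1 : tail F u ≤ expWeight γ (-1) * tail F (u - 1) := by
    calc tail F u = expWeight γ (-1) * (expWeight γ 1 * tail F u) := by
          rw [← mul_assoc, ← expWeight_add]; simp
      _ ≤ _ := by gcongr; exact h 1 u zero_le_one hu
  have h2 : tail F (u - 1) = F (Ioc (u - 1) u) + tail F u := by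
    rw [tail, tail, ← Ioc_union_Ioi_eq_Ioi (show u - 1 ≤ u by linarith),
      measure_union (Ioc_disjoint_Ioi le_rfl) measurableSet_Ioi]
  rw [ENNReal.sub_mul (fun _ _ => tail_ne_top _ _), one_mul, tsub_le_iff_right]
  calc _ = F (Ioc (u - 1) u) + tail F u := h2
    _ ≤ _ := by gcongr

/-- Cut the window into `L` unit intervals. On the one with left end `w` the integral is at least
`(1 - e^{-γ}) e^{γ w} F̄(w)`, and by monotonicity `e^{γ w} F̄(w) ≥ e^{γ v} F̄(v)`. -/
lemma ExpTilted.le_setLIntegral_expWeight {γ : ℝ} (hγ : 0 < γ) {F : Measure ℝ}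
    [IsProbabilityMeasure F] (h : ExpTilted γ F) {v : ℝ} (L : ℕ) (hL : L ≤ v) :
    L * ((1 - expWeight γ (-1)) * (expWeight γ v * tail F v))
      ≤ ∫⁻ y in Ioc (v - L) v, expWeight γ y ∂F := by
  induction L with
  | zero => simp
  | succ L ih =>
    push_cast at hL ⊢
    have hu : Ioc (v - (L + 1)) v = Ioc (v - L - 1) (v - L) ∪ Ioc (v - L) v := by
      rw [Ioc_union_Ioc_eq_Ioc (by linarith) (by linarith [L.cast_nonneg (α := ℝ)])]
      congr 1; ring
    rw [hu, lintegral_union measurableSet_Ioc (Ioc_disjoint_Ioc_of_le le_rfl), add_mul, one_mul,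
      add_comm]
    refine add_le_add ?_ (ih (by linarith))
    calc (1 - expWeight γ (-1)) * (expWeight γ v * tail F v)
        = (1 - expWeight γ (-1)) * (expWeight γ (v - L - 1) * (expWeight γ (L + 1) * tail F v)) := by
          rw [← mul_assoc (expWeight γ (v - L - 1)), ← expWeight_add]
          congr 4; ring
      _ ≤ (1 - expWeight γ (-1)) * (expWeight γ (v - L - 1) * tail F (v - L - 1)) := by
          gcongr
          rw [sub_sub]
          exact h _ _ (by positivity) hL
      _ = expWeight γ (v - L - 1) * ((1 - expWeight γ (-1)) * tail F (v - L - 1)) := by ring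
      _ ≤ expWeight γ (v - L - 1) * F (Ioc (v - L - 1) (v - L)) := by
          gcongr
          exact h.mul_tail_le_measure_Ioc (by linarith)
      _ = ∫⁻ _ in Ioc (v - L - 1) (v - L), expWeight γ (v - L - 1) ∂F := by simp
      _ ≤ _ := setLIntegral_mono' measurableSet_Ioc fun y hy => expWeight_mono hγ hy.1.le

lemma ExpTilted.le_expMoment {γ : ℝ} (hγ : 0 < γ) {F : Measure ℝ} [IsProbabilityMeasure F]
    (h : ExpTilted γ F) (L : ℕ) :
    L * ((1 - expWeight γ (-1)) * (expWeight γ L * tail F L)) ≤ expMoment γ F := by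
  refine (h.le_setLIntegral_expWeight hγ L le_rfl).trans (lintegral_mono_set ?_)
  intro y hy
  simp at hy
  exact hy.1.le

lemma one_sub_expWeight_ne_zero {γ : ℝ} (hγ : 0 < γ) : 1 - expWeight γ (-1) ≠ 0 := by
  rw [Ne, tsub_eq_zero_iff_le, not_le, expWeight, ENNReal.ofReal_lt_one, Real.exp_lt_one_iff]
  linarith

/-! ### Self-convolution across the exceptional points -/

/-- Past `b`, the tail of `F` decays at most exponentially on a window of length `L`. -/
def FlatAfter (γ : ℝ) (F : Measure ℝ) (b L : ℝ) : Prop :=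
  ∀ w, 0 ≤ w → w ≤ L → expWeight γ (-w) * tail F b ≤ tail F (b + w)

/-- On the window `x - y` lies in `[b, b + L]`, so flatness replaces `F̄(x - y)` by `e^{-γ (x - b)}
e^{γ y} F̄(b)`, and the weighted integral is already bounded below. -/
lemma ExpTilted.le_setLIntegral_tail {γ : ℝ} (hγ : 0 < γ) {F : Measure ℝ}
    [IsProbabilityMeasure F] (h : ExpTilted γ F) {b x : ℝ} {L : ℕ} (hb : FlatAfter γ F b L)
    (hx : L ≤ x - b) :
    L * ((1 - expWeight γ (-1)) * (tail F b * tail F (x - b)))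
      ≤ ∫⁻ y in Ioc (x - b - L) (x - b), tail F (x - y) ∂F := by
  calc _ = expWeight γ (-(x - b)) * tail F b *
        (L * ((1 - expWeight γ (-1)) * (expWeight γ (x - b) * tail F (x - b)))) := by
        have : expWeight γ (-(x - b)) * expWeight γ (x - b) = 1 := by rw [← expWeight_add]; simp
        calc _ = expWeight γ (-(x - b)) * expWeight γ (x - b) *
              (L * ((1 - expWeight γ (-1)) * (tail F b * tail F (x - b)))) := by
              rw [this, one_mul]
          _ = _ := by ring
    _ ≤ expWeight γ (-(x - b)) * tail F b *
        ∫⁻ y in Ioc (x - b - L) (x - b), expWeight γ y ∂F := by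
        gcongr
        exact h.le_setLIntegral_expWeight hγ L hx
    _ = ∫⁻ y in Ioc (x - b - L) (x - b), expWeight γ (-(x - b)) * tail F b * expWeight γ y ∂F :=
        (lintegral_const_mul _ (measurable_expWeight γ)).symm
    _ ≤ _ := setLIntegral_mono' measurableSet_Ioc fun y hy => by
        rw [mul_right_comm, ← expWeight_add]
        have := hb (x - b - y) (by linarith [hy.2]) (by linarith [hy.1])
        rw [show b + (x - b - y) = x - y by ring] at this
        rwa [show -(x - b) + y = -(x - b - y) by ring]

lemma setLIntegral_tail_le {F : Measure ℝ} [IsProbabilityMeasure F] (b x K : ℝ) :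
    ∫⁻ y in {y | |x - y - b| ≤ K}, tail F (x - y) ∂F ≤ tail F (b - K) * tail F (x - b - (K + 1)) := by
  calc _ ≤ ∫⁻ _ in {y | |x - y - b| ≤ K}, tail F (b - K) ∂F := by
        refine setLIntegral_mono' (measurableSet_le (by fun_prop) (by fun_prop)) fun y hy => ?_
        exact tail_antitone F (by linarith [(abs_le.1 (mem_ofPred.1 hy)).1])
    _ = tail F (b - K) * F {y | |x - y - b| ≤ K} := by simp
    _ ≤ _ := by
        gcongr
        refine measure_mono fun y hy => ?_
        have := (abs_le.1 (mem_ofPred.1 hy)).2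
        simp only [mem_Ioi]; linarith

/-- Both sides compare with `F̄(b) F̄(x - b)`: the left has a constant independent of `L`, the right
integral one proportional to `L`. -/
lemma setLIntegral_tail_near_le {γ : ℝ} (hγ : 0 < γ) {F : Measure ℝ}
    [IsProbabilityMeasure F] (h : ExpTilted γ F) (hs : ShiftDominated F) {K : ℝ} {ε : ℝ≥0∞}
    (hε : ε ≠ 0) : ∃ L : ℕ, ∀ b x, FlatAfter γ F b L → L ≤ x - b →
      ∫⁻ y in {y | |x - y - b| ≤ K}, tail F (x - y) ∂F
        ≤ ε * ∫⁻ y in Ioc (x - b - L) (x - b), tail F (x - y) ∂F := by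
  obtain ⟨c, hc, h1⟩ := hs K
  obtain ⟨d, hd, h2⟩ := hs (K + 1)
  obtain ⟨L, hL⟩ := ENNReal.exists_nat_mul_gt (mul_ne_zero hε (one_sub_expWeight_ne_zero hγ))
    (ENNReal.mul_ne_top hc hd)
  refine ⟨L, fun b x hb hx => ?_⟩
  calc _ ≤ tail F (b - K) * tail F (x - b - (K + 1)) := setLIntegral_tail_le b x K
    _ ≤ (c * tail F b) * (d * tail F (x - b)) := by gcongr; exacts [h1 b, h2 (x - b)]
    _ = c * d * (tail F b * tail F (x - b)) := by ring
    _ ≤ (L * (ε * (1 - expWeight γ (-1)))) * (tail F b * tail F (x - b)) := by gcongr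
    _ = ε * (L * ((1 - expWeight γ (-1)) * (tail F b * tail F (x - b)))) := by ring
    _ ≤ _ := by gcongr; exact h.le_setLIntegral_tail hγ hb hx

lemma tail_convolution_near_negl {γ : ℝ} (hγ : 0 < γ) {F : Measure ℝ}
    [IsProbabilityMeasure F] (h : ExpTilted γ F) (hs : ShiftDominated F)
    (hN : Negl (tail F) (tail (F.conv F))) {β : ℕ → ℝ}
    (hβ : ∀ L : ℝ, ∀ᶠ n in atTop, β n + L ≤ β (n + 1) ∧ FlatAfter γ F (β n) L) (K : ℝ)
    {ε : ℝ≥0∞} (hε : ε ≠ 0) : ∃ N, ∀ᶠ x in atTop,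
      ∫⁻ y in {y | ∃ n ≥ N, |x - y - β n| ≤ K}, tail F (x - y) ∂F ≤ ε * tail (F.conv F) x := by
  have hε2 := (ENNReal.half_pos hε).ne'
  obtain ⟨L, hL⟩ := setLIntegral_tail_near_le hγ h hs (K := K) hε2
  obtain ⟨N, hN'⟩ := eventually_atTop.1 (hβ L)
  obtain ⟨c, hc, hcs⟩ := hs (L + K)
  have hmono : ∀ n m, N ≤ n → n < m → β n + L ≤ β m := by
    intro n m hn hm
    induction m, hm using Nat.le_induction with
    | base => exact (hN' n hn).1
    | succ m hm ih =>
      have := (hN' m (by omega)).1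
      linarith [L.cast_nonneg (α := ℝ)]
  refine ⟨N, ?_⟩
  filter_upwards [hN.of_le_mul hc hcs _ hε2] with x hx
  set S : ℕ → Set ℝ := fun n => {y | N ≤ n ∧ β n + L ≤ x ∧ |x - y - β n| ≤ K} with hS
  set R : ℕ → Set ℝ := fun n => {y | N ≤ n ∧ β n + L ≤ x ∧ y ∈ Ioc (x - β n - L) (x - β n)} with hR
  have hRm : ∀ n, MeasurableSet (R n) := fun n =>
    (MeasurableSet.const _).inter ((MeasurableSet.const _).inter measurableSet_Ioc)
  have hRd : Pairwise (Function.onFun Disjoint R) := by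
    rw [pairwise_disjoint_on]
    intro n m hnm
    refine Set.disjoint_left.2 fun y hy hy' => ?_
    have := hmono n m hy.1 hnm
    linarith [hy.2.2.1, hy'.2.2.2]
  -- If `x - β n < L` there is no room for the window. Such `y` satisfy `y < L + K`, and their total
  -- contribution is at most `F̄(x - (L + K))`, which is negligible.
  have hcover : {y | ∃ n ≥ N, |x - y - β n| ≤ K} ⊆ (⋃ n, S n) ∪ Iio (L + K) := by
    rintro y ⟨n, hn, hy⟩
    rcases le_or_gt (β n + L) x with hx | hx
    · exact Or.inl (mem_iUnion.2 ⟨n, hn, hx, hy⟩)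
    · right
      have := (abs_le.1 hy).1
      simp only [mem_Iio]; linarith
  have hSR : ∀ n, ∫⁻ y in S n, tail F (x - y) ∂F ≤ ε / 2 * ∫⁻ y in R n, tail F (x - y) ∂F := by
    intro n
    by_cases hn : N ≤ n ∧ β n + L ≤ x
    · have h1 : S n = {y | |x - y - β n| ≤ K} := by ext y; simp [hS, hn]
      have h2 : R n = Ioc (x - β n - L) (x - β n) := by ext y; simp [hR, hn]
      rw [h1, h2]
      exact hL _ _ (hN' n hn.1).2 (by linarith [hn.2])
    · have h1 : S n = ∅ := by
        ext y
        simp only [hS, mem_ofPred_eq, mem_empty_iff_false, iff_false]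
        exact fun hy => hn ⟨hy.1, hy.2.1⟩
      simp [h1]
  calc _ ≤ ∫⁻ y in (⋃ n, S n) ∪ Iio (L + K), tail F (x - y) ∂F := lintegral_mono_set hcover
    _ ≤ ∫⁻ y in ⋃ n, S n, tail F (x - y) ∂F + ∫⁻ y in Iio (L + K), tail F (x - y) ∂F :=
        lintegral_union_le _ _ _
    _ ≤ ε / 2 * tail (F.conv F) x + ε / 2 * tail (F.conv F) x := by
        gcongr
        · calc _ ≤ ∑' n, ∫⁻ y in S n, tail F (x - y) ∂F := lintegral_iUnion_le _ _
            _ ≤ ∑' n, ε / 2 * ∫⁻ y in R n, tail F (x - y) ∂F := ENNReal.tsum_le_tsum hSR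
            _ = ε / 2 * ∫⁻ y in ⋃ n, R n, tail F (x - y) ∂F := by
                rw [ENNReal.tsum_mul_left, lintegral_iUnion hRm hRd]
            _ ≤ _ := by
                rw [tail_conv]; exact mul_le_mul_right (setLIntegral_le_lintegral _ _) _
        · calc _ ≤ ∫⁻ _ in Iio (L + K), tail F (x - (L + K)) ∂F :=
                setLIntegral_mono' measurableSet_Iio fun y hy =>
                  tail_antitone F (by linarith [mem_Iio.1 hy])
            _ ≤ tail F (x - (L + K)) * 1 := by
                rw [setLIntegral_const]; gcongr; exact prob_le_one
            _ ≤ _ := by rw [mul_one]; exact hx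
    _ = _ := by rw [← add_mul, ENNReal.add_halves]

/-- Off the points `β n`, the tail of `F` is asymptotically at most `c` times its shift. -/
def UpperShiftOff (γ : ℝ) (F : Measure ℝ) (β : ℕ → ℝ) : Prop :=
  ∀ t : ℝ, 0 < t → ∀ c, expWeight γ t < c → ∃ K : ℝ, ∀ N : ℕ, ∀ᶠ u in atTop,
    tail F (u - t) ≤ c * tail F u ∨ ∃ n ≥ N, |u - β n| ≤ K

lemma ExpTilted.tail_sub_le_of_nonpos {γ : ℝ} {F : Measure ℝ} (h : ExpTilted γ F) {t u : ℝ}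
    (ht : t ≤ 0) (hu : 0 ≤ u) : tail F (u - t) ≤ expWeight γ t * tail F u := by
  have := h (-t) (u - t) (by linarith) (by linarith)
  calc tail F (u - t) = expWeight γ t * (expWeight γ (-t) * tail F (u - t)) := by
        rw [← mul_assoc, ← expWeight_add]; simp
    _ ≤ expWeight γ t * tail F u := by
        gcongr
        rwa [show u - t - -t = u by ring] at this

/-- Split the convolution integral into three sets of `y`: good points, where the shift constant is
`c₁`; points near some `β n`, where a crude constant `C` is affordable because the set is
negligible; and `y > x - A`. -/
lemma upperShift_conv_self {γ : ℝ} (hγ : 0 < γ) {F : Measure ℝ}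
    [IsProbabilityMeasure F] (h : ExpTilted γ F) (hs : ShiftDominated F)
    (hN : Negl (tail F) (tail (F.conv F))) {β : ℕ → ℝ}
    (hβ : ∀ L : ℝ, ∀ᶠ n in atTop, β n + L ≤ β (n + 1) ∧ FlatAfter γ F (β n) L)
    (ho : UpperShiftOff γ F β) : UpperShift γ (F.conv F) := by
  intro t c hc
  have hNA : ∀ A, Negl (fun x => tail F (x - A)) (tail (F.conv F)) := fun A => by
    obtain ⟨d, hd, hA⟩ := hs A
    exact hN.of_le_mul hd hA
  rcases le_or_gt t 0 with ht | ht
  · exact eventually_tail_conv_shift_le hc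
      ((eventually_ge_atTop 0).mono fun u hu => h.tail_sub_le_of_nonpos ht hu) hNA
  obtain ⟨c₁, hc₁, h1⟩ := exists_between hc
  obtain ⟨r, hr, hcr⟩ := ENNReal.lt_iff_exists_add_pos_lt.1 h1
  have hr2 : (r : ℝ≥0∞) / 2 ≠ 0 := (ENNReal.half_pos (by exact_mod_cast hr.ne')).ne'
  obtain ⟨K, hK⟩ := ho t ht c₁ hc₁
  obtain ⟨C, hC, hCt⟩ := hs t
  obtain ⟨N, hbad⟩ := tail_convolution_near_negl hγ h hs hN hβ K (ENNReal.div_pos hr2 hC).ne'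
  obtain ⟨A, hA⟩ := eventually_atTop.1 (hK N)
  filter_upwards [hbad, hNA A _ hr2] with x hx hxA
  set B := {y | ∃ n ≥ N, |x - y - β n| ≤ K} with hB
  have hBm : MeasurableSet B := by
    have : B = ⋃ n, ⋃ _ : n ≥ N, {y | |x - y - β n| ≤ K} := by ext y; simp [hB]
    rw [this]
    exact MeasurableSet.iUnion fun n => MeasurableSet.iUnion fun _ =>
      measurableSet_le (by fun_prop) (by fun_prop)
  have hm := measurable_tail_sub F x
  have hpt : ∀ y, tail F (x - t - y) ≤ c₁ * tail F (x - y) +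
      (C * B.indicator (fun y => tail F (x - y)) y + (Ioi (x - A)).indicator 1 y) := by
    intro y
    by_cases hy : y ∈ Ioi (x - A)
    · rw [indicator_of_mem hy]
      exact (tail_le_one F _).trans (le_add_self.trans le_add_self)
    · rw [show x - t - y = x - y - t by ring]
      rcases hA (x - y) (by simp at hy; linarith) with h1 | h1
      · exact h1.trans le_self_add
      · rw [indicator_of_mem (show y ∈ B from h1)]
        exact (hCt _).trans (le_self_add.trans le_add_self)
  calc tail (F.conv F) (x - t) = ∫⁻ y, tail F (x - t - y) ∂F := tail_conv _ _ _
    _ ≤ ∫⁻ y, (c₁ * tail F (x - y) +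
      (C * B.indicator (fun y => tail F (x - y)) y + (Ioi (x - A)).indicator 1 y)) ∂F :=
        lintegral_mono hpt
    _ = c₁ * tail (F.conv F) x + (C * ∫⁻ y in B, tail F (x - y) ∂F + tail F (x - A)) := by
        rw [lintegral_add_left (hm.const_mul _),
          lintegral_add_left ((hm.indicator hBm).const_mul _), lintegral_const_mul _ hm,
          lintegral_const_mul _ (hm.indicator hBm), lintegral_indicator hBm,
          lintegral_indicator_one measurableSet_Ioi, tail_conv, tail]
    _ ≤ c₁ * tail (F.conv F) x + (C * (r / 2 / C * tail (F.conv F) x)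
        + r / 2 * tail (F.conv F) x) := by gcongr
    _ ≤ c₁ * tail (F.conv F) x + (r / 2 * tail (F.conv F) x + r / 2 * tail (F.conv F) x) := by
        refine add_le_add le_rfl (add_le_add ?_ le_rfl)
        rw [← mul_assoc]
        exact mul_le_mul_left ENNReal.mul_div_le _
    _ = (c₁ + r) * tail (F.conv F) x := by rw [← add_mul, ENNReal.add_halves, add_mul]
    _ ≤ _ := by gcongr

/-! ### The tail of `(1 + U^{1/b})^s` -/

/-- Bernoulli's inequality, rescaled: a convex power lies above its tangent. -/
lemma rpow_tangent_le {x y p : ℝ} (hx : 0 < x) (hy : 0 ≤ y) (hp : 1 ≤ p) :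
    x ^ p + p * x ^ (p - 1) * (y - x) ≤ y ^ p := by
  have h := one_add_mul_self_le_rpow_one_add (s := y / x - 1)
    (by linarith [div_nonneg hy hx.le]) hp
  rw [add_sub_cancel, Real.div_rpow hy hx.le, le_div_iff₀ (Real.rpow_pos_of_pos hx p)] at h
  calc _ = (1 + p * (y / x - 1)) * x ^ p := by
        rw [Real.rpow_sub_one hx.ne']; field_simp
    _ ≤ _ := h

lemma rpow_one_div_sub_le {x y s : ℝ} (hs : 1 ≤ s) (hx : 1 ≤ x) (hxy : x ≤ y) :
    y ^ (1 / s) - x ^ (1 / s) ≤ y - x := by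
  have hx0 : 0 ≤ x := by linarith
  have hy0 : 0 ≤ y := by linarith
  have hs0 : (0 : ℝ) < s := by linarith
  have hw : 1 ≤ x ^ (1 / s) := Real.one_le_rpow hx (by positivity)
  have hv : x ^ (1 / s) ≤ y ^ (1 / s) := Real.rpow_le_rpow hx0 hxy (by positivity)
  have h := rpow_tangent_le (show 0 < x ^ (1 / s) by linarith) (show 0 ≤ y ^ (1 / s) by linarith) hs
  have e : ∀ z : ℝ, 0 ≤ z → (z ^ (1 / s)) ^ s = z := fun z hz => by
    rw [← Real.rpow_mul hz, one_div, inv_mul_cancel₀ hs0.ne', Real.rpow_one]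
  rw [e x hx0, e y hy0] at h
  have h1 : 1 ≤ (x ^ (1 / s)) ^ (s - 1) := Real.one_le_rpow hw (by linarith)
  nlinarith [mul_nonneg (sub_nonneg.2 hv) (show 0 ≤ s * (x ^ (1 / s)) ^ (s - 1) - 1 by nlinarith)]

/-- The base `(clamp z)^{1/s}`, where `clamp z` is the nearest point to `z` of `[1, 2^s]`. -/
noncomputable def clampRoot (s z : ℝ) : ℝ := (max 1 (min z (2 ^ s))) ^ (1 / s)

/-- The tail of `(1 + U^{1/b})^s` for `U` uniform on `(0, 1)`. -/
noncomputable def powTail (b s z : ℝ) : ℝ := 1 - (clampRoot s z - 1) ^ b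

section powTail

variable {b s : ℝ}

lemma one_le_clampRoot (hs : 1 ≤ s) (z : ℝ) : 1 ≤ clampRoot s z :=
  Real.one_le_rpow (le_max_left _ _) (by positivity)

lemma two_rpow_one_div (hs : 1 ≤ s) : ((2 : ℝ) ^ s) ^ (1 / s) = 2 := by
  rw [← Real.rpow_mul zero_le_two, one_div, mul_inv_cancel₀ (by linarith), Real.rpow_one]

lemma one_le_two_rpow (hs : 1 ≤ s) : (1 : ℝ) ≤ 2 ^ s :=
  Real.one_le_rpow one_le_two (by linarith)

lemma two_le_two_rpow (hs : 1 ≤ s) : (2 : ℝ) ≤ 2 ^ s := by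
  simpa using Real.rpow_le_rpow_of_exponent_le one_le_two hs

lemma clampRoot_mono (hs : 1 ≤ s) : Monotone (clampRoot s) := fun x y h =>
  Real.rpow_le_rpow (by positivity) (by gcongr) (by positivity)

lemma clampRoot_of_le_one {z : ℝ} (hz : z ≤ 1) : clampRoot s z = 1 := by
  rw [clampRoot, max_eq_left ((min_le_left _ _).trans hz), Real.one_rpow]

lemma clampRoot_of_ge (hs : 1 ≤ s) {z : ℝ} (hz : 2 ^ s ≤ z) : clampRoot s z = 2 := by
  rw [clampRoot, min_eq_right hz, max_eq_right (one_le_two_rpow hs), two_rpow_one_div hs]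

lemma clampRoot_of_mem {z : ℝ} (h1 : 1 ≤ z) (h2 : z ≤ 2 ^ s) : clampRoot s z = z ^ (1 / s) := by
  rw [clampRoot, min_eq_left h2, max_eq_right h1]

lemma clampRoot_le_two (hs : 1 ≤ s) (z : ℝ) : clampRoot s z ≤ 2 := by
  rw [← clampRoot_of_ge hs (le_max_right z _)]
  exact clampRoot_mono hs (le_max_left _ _)

lemma clampRoot_sub_le (hs : 1 ≤ s) {x y : ℝ} (h : x ≤ y) :
    clampRoot s y - clampRoot s x ≤ y - x := by
  refine (rpow_one_div_sub_le hs (le_max_left _ _) (by gcongr)).trans ?_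
  rcases max_cases 1 (min x (2 ^ s)) with h1 | h1 <;>
  rcases max_cases 1 (min y (2 ^ s)) with h2 | h2 <;>
  rcases min_cases x (2 ^ s) with h3 | h3 <;>
  rcases min_cases y (2 ^ s) with h4 | h4 <;> linarith

lemma powTail_antitone (hb : 1 ≤ b) (hs : 1 ≤ s) : Antitone (powTail b s) := fun x y h => by
  have := one_le_clampRoot hs x
  have := clampRoot_mono hs h
  have := Real.rpow_le_rpow (z := b) (show 0 ≤ clampRoot s x - 1 by linarith)
    (show clampRoot s x - 1 ≤ clampRoot s y - 1 by linarith) (by linarith)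
  simp only [powTail]; linarith

lemma powTail_of_le_one (hb : 1 ≤ b) {z : ℝ} (hz : z ≤ 1) : powTail b s z = 1 := by
  rw [powTail, clampRoot_of_le_one hz, sub_self, Real.zero_rpow (by linarith), sub_zero]

lemma powTail_of_ge (hs : 1 ≤ s) {z : ℝ} (hz : 2 ^ s ≤ z) : powTail b s z = 0 := by
  rw [powTail, clampRoot_of_ge hs hz]; norm_num

lemma powTail_nonneg (hb : 1 ≤ b) (hs : 1 ≤ s) (z : ℝ) : 0 ≤ powTail b s z := by
  rw [← powTail_of_ge (b := b) hs (le_max_right z _)]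
  exact powTail_antitone hb hs (le_max_left _ _)

lemma powTail_le_one (hb : 1 ≤ b) (hs : 1 ≤ s) (z : ℝ) : powTail b s z ≤ 1 := by
  rw [← powTail_of_le_one (s := s) hb (min_le_right z 1)]
  exact powTail_antitone hb hs (min_le_left _ _)

lemma powTail_sub_le (hb : 1 ≤ b) (hs : 1 ≤ s) {x y : ℝ} (h : x ≤ y) :
    powTail b s x - powTail b s y ≤ b * (y - x) := by
  have h1 := one_le_clampRoot hs x
  have h2 := clampRoot_mono hs h
  have h3 := clampRoot_le_two hs y
  have h4 := clampRoot_sub_le hs h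
  refine le_trans ?_ (mul_le_mul_of_nonneg_left h4 (by linarith))
  rw [powTail, powTail]
  rcases (h1.trans h2).eq_or_lt with h5 | h5
  · have h6 : clampRoot s x = 1 := by linarith
    simp [h6, ← h5]
  · have := rpow_tangent_le (sub_pos.2 h5) (sub_nonneg.2 h1) hb
    have h7 : (clampRoot s y - 1) ^ (b - 1) ≤ 1 :=
      Real.rpow_le_one (by linarith) (by linarith) (by linarith)
    nlinarith [mul_nonneg (mul_nonneg (show 0 ≤ b by linarith) (sub_nonneg.2 h7))
      (sub_nonneg.2 h2)]

/-- With `w` the clamped root, `1 - (w - 1)^b ≥ 2 - w`, and the tangent of `w^s` at `w = 2`, of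
slope `s 2^{s-1}`, bounds `2 - w` below. The decay to zero at `2^s` is thus at least linear. -/
lemma le_powTail (hb : 1 ≤ b) (hs : 1 ≤ s) {z d : ℝ} (hd0 : 0 ≤ d) (hd : d ≤ 1)
    (hz : z ≤ 2 ^ s - d) : (s * 2 ^ (s - 1))⁻¹ * d ≤ powTail b s z := by
  have hc : 1 ≤ s * (2 : ℝ) ^ (s - 1) :=
    one_le_mul_of_one_le_of_one_le hs (Real.one_le_rpow one_le_two (by linarith))
  rw [inv_mul_le_iff₀ (by linarith)]
  rcases le_or_gt z 1 with h1 | h1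
  · rw [powTail_of_le_one hb h1]; linarith
  · have hw := clampRoot_of_mem h1.le (show z ≤ 2 ^ s by linarith)
    have h2 := one_le_clampRoot hs z
    have h3 := clampRoot_le_two hs z
    have h4 := rpow_tangent_le zero_lt_two (show 0 ≤ clampRoot s z by linarith) hs
    have h5 : clampRoot s z ^ s = z := by
      rw [hw, ← Real.rpow_mul (by linarith), one_div, inv_mul_cancel₀ (by linarith),
        Real.rpow_one]
    have h6 : (clampRoot s z - 1) ^ b ≤ clampRoot s z - 1 := by
      simpa using Real.rpow_le_rpow_of_exponent_ge' (show 0 ≤ clampRoot s z - 1 by linarith)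
        (by linarith) zero_le_one hb
    rw [powTail]
    rw [h5] at h4
    nlinarith

lemma lt_rpow_iff_clampRoot_lt (hb : 1 ≤ b) (hs : 1 ≤ s) {z u : ℝ} (hu : u ∈ Ioo (0 : ℝ) 1) :
    z < (1 + u ^ (1 / b)) ^ s ↔ (clampRoot s z - 1) ^ b < u := by
  have hb0 : (0 : ℝ) < b := by linarith
  have hs0 : (0 : ℝ) < s := by linarith
  have hv0 : 0 < u ^ (1 / b) := Real.rpow_pos_of_pos hu.1 _
  have hv1 : u ^ (1 / b) < 1 := Real.rpow_lt_one hu.1.le hu.2 (by positivity)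
  rcases le_or_gt z 1 with h1 | h1
  · rw [clampRoot_of_le_one h1, sub_self, Real.zero_rpow hb0.ne']
    exact iff_of_true (h1.trans_lt (Real.one_lt_rpow (by linarith) hs0)) hu.1
  rcases le_or_gt (2 ^ s) z with h2 | h2
  · rw [clampRoot_of_ge hs h2]
    refine iff_of_false (not_lt.2 (le_trans ?_ h2)) (by norm_num; exact hu.2.le)
    exact Real.rpow_le_rpow (by linarith) (by linarith) hs0.le
  · have h3 := one_le_clampRoot hs z
    rw [clampRoot_of_mem h1.le h2.le] at h3 ⊢
    rw [← Real.lt_rpow_inv_iff_of_pos (by linarith) hu.1.le hb0, ← one_div, sub_lt_iff_lt_add',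
      one_div s, Real.rpow_inv_lt_iff_of_pos (by linarith) (by linarith) hs0]

lemma unifLaw_lt_rpow (hb : 1 ≤ b) (hs : 1 ≤ s) (z : ℝ) :
    unifLaw {u | z < (1 + u ^ (1 / b)) ^ s} = ENNReal.ofReal (powTail b s z) := by
  rw [unifLaw, Measure.restrict_apply (measurableSet_lt (by fun_prop) (by fun_prop))]
  have h0 : 0 ≤ (clampRoot s z - 1) ^ b :=
    Real.rpow_nonneg (by linarith [one_le_clampRoot hs z]) _
  have : {u : ℝ | z < (1 + u ^ (1 / b)) ^ s} ∩ Ioo 0 1 = Ioo ((clampRoot s z - 1) ^ b) 1 := by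
    ext u
    constructor
    · rintro ⟨h, hu⟩
      exact ⟨(lt_rpow_iff_clampRoot_lt hb hs hu).1 h, hu.2⟩
    · intro h
      have hu : u ∈ Ioo (0 : ℝ) 1 := ⟨h0.trans_lt h.1, h.2⟩
      exact ⟨(lt_rpow_iff_clampRoot_lt hb hs hu).2 h.1, hu⟩
  rw [this, Real.volume_Ioo, powTail]

end powTail

/-! ### The tail of the mixture -/

/-- Rapidly growing scales `a n` with weights `q n`, as in the law of `η`. -/
structure Scales (b s : ℝ) (a q : ℕ → ℝ) : Prop where
  one_le_b : 1 ≤ b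
  one_le_s : 1 ≤ s
  two_le : ∀ n, 2 ≤ a n
  grow : ∀ n, 4 * (2 ^ s * a n) ≤ a (n + 1)
  pos : ∀ n, 0 < q n
  succ : ∀ n, q (n + 1) = q n / a n
  hasSum : HasSum q 1
  tendsto : Tendsto (fun n => q n * a n) atTop atTop

/-- The tail of the mixture of the laws of `a n (1 + U^{1/b})^s` with weights `q n`. -/
noncomputable def mixTail (b s : ℝ) (a q : ℕ → ℝ) (x : ℝ) : ℝ :=
  ∑' n, q n * powTail b s (x / a n)

namespace Scales

variable {b s : ℝ} {a q : ℕ → ℝ} (h : Scales b s a q)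
include h

lemma a_pos (n : ℕ) : 0 < a n := by linarith [h.two_le n]

lemma le_two_rpow_mul (n : ℕ) : a n ≤ 2 ^ s * a n :=
  le_mul_of_one_le_left (h.a_pos n).le (one_le_two_rpow h.one_le_s)

lemma add_le_succ (n : ℕ) : a n + 1 ≤ a (n + 1) := by
  linarith [h.le_two_rpow_mul n, h.grow n, h.two_le n]

lemma strictMono : StrictMono a := strictMono_nat_of_lt_succ fun n => by
  linarith [h.add_le_succ n]

lemma cast_le (n : ℕ) : (n : ℝ) ≤ a n := by
  induction n with
  | zero => simpa using (h.a_pos 0).le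
  | succ n ih => push_cast; linarith [h.add_le_succ n]

lemma tendsto_a : Tendsto a atTop atTop :=
  tendsto_atTop_mono h.cast_le tendsto_natCast_atTop_atTop

lemma exists_mem_Ico {N : ℕ} {x : ℝ} (hx : a N ≤ x) : ∃ n, N ≤ n ∧ a n ≤ x ∧ x < a (n + 1) := by
  have hex : ∃ m, x < a m := (h.tendsto_a.eventually_gt_atTop x).exists
  classical
  have hm := Nat.find_spec hex
  have hNm : N < Nat.find hex := h.strictMono.lt_iff_lt.1 (hx.trans_lt hm)
  obtain ⟨n, hn⟩ : ∃ n, Nat.find hex = n + 1 := ⟨Nat.find hex - 1, by omega⟩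
  rw [hn] at hm hNm
  exact ⟨n, by omega, not_lt.1 (Nat.find_min hex (by omega)), hm⟩

lemma scaled_le {k n : ℕ} (hkn : k < n) : 4 * (2 ^ s * a k) ≤ a n :=
  (h.grow k).trans (h.strictMono.monotone hkn)

lemma summable (x : ℝ) : Summable fun n => q n * powTail b s (x / a n) :=
  h.hasSum.summable.of_nonneg_of_le
    (fun n => mul_nonneg (h.pos n).le (powTail_nonneg h.one_le_b h.one_le_s _))
    fun n => mul_le_of_le_one_right (h.pos n).le (powTail_le_one h.one_le_b h.one_le_s _)

lemma term_nonneg (n : ℕ) (x : ℝ) : 0 ≤ q n * powTail b s (x / a n) :=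
  mul_nonneg (h.pos n).le (powTail_nonneg h.one_le_b h.one_le_s _)

lemma powTail_div_of_le {n : ℕ} {x : ℝ} (hx : x ≤ a n) : powTail b s (x / a n) = 1 :=
  powTail_of_le_one h.one_le_b ((div_le_one (h.a_pos n)).2 hx)

lemma powTail_div_of_ge {n : ℕ} {x : ℝ} (hx : 2 ^ s * a n ≤ x) : powTail b s (x / a n) = 0 :=
  powTail_of_ge h.one_le_s ((le_div_iff₀ (h.a_pos n)).2 hx)

lemma mixTail_antitone : Antitone (mixTail b s a q) := fun x y hxy =>
  (h.summable y).tsum_le_tsum (fun n => mul_le_mul_of_nonneg_left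
    (powTail_antitone h.one_le_b h.one_le_s (div_le_div_of_nonneg_right hxy (h.a_pos n).le))
    (h.pos n).le) (h.summable x)

lemma mixTail_of_le {x : ℝ} (hx : x ≤ 2) : mixTail b s a q x = 1 := by
  rw [mixTail, ← h.hasSum.tsum_eq]
  exact tsum_congr fun n => by rw [h.powTail_div_of_le (hx.trans (h.two_le n)), mul_one]

lemma term_le_mixTail (n : ℕ) (x : ℝ) : q n * powTail b s (x / a n) ≤ mixTail b s a q x :=
  (h.summable x).le_tsum n fun k _ => h.term_nonneg k x

lemma weight_le_mixTail {n : ℕ} {x : ℝ} (hx : x ≤ a n) : q n ≤ mixTail b s a q x := by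
  simpa [h.powTail_div_of_le hx] using h.term_le_mixTail n x

lemma mixTail_pos (x : ℝ) : 0 < mixTail b s a q x := by
  obtain ⟨n, hn⟩ := (h.tendsto_a.eventually_ge_atTop x).exists
  exact (h.pos n).trans_le (h.weight_le_mixTail hn)

/-- Only the `n`-th summand can change on `[x, y]`: earlier ones already vanish and later ones still
equal their weight. -/
lemma mixTail_eq_add {n : ℕ} {x y : ℝ} (hxy : x ≤ y) (hy : y ≤ a (n + 1))
    (hx : ∀ k < n, 2 ^ s * a k ≤ x) : mixTail b s a q x =
      mixTail b s a q y + q n * (powTail b s (x / a n) - powTail b s (y / a n)) := by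
  rw [← sub_eq_iff_eq_add', mixTail, mixTail, ← (h.summable x).tsum_sub (h.summable y),
    tsum_eq_single n, mul_sub]
  intro k hk
  rcases lt_or_gt_of_ne hk with hk | hk
  · rw [h.powTail_div_of_ge (hx k hk), h.powTail_div_of_ge ((hx k hk).trans hxy), sub_self]
  · have := h.strictMono.monotone (Nat.succ_le_of_lt hk)
    rw [h.powTail_div_of_le (hy.trans this), h.powTail_div_of_le (hxy.trans (hy.trans this)),
      sub_self]

lemma mixTail_flat {n : ℕ} {x y : ℝ} (hx : 2 ^ s * a n ≤ x) (hxy : x ≤ y) (hy : y ≤ a (n + 1)) :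
    mixTail b s a q x = mixTail b s a q y := by
  rw [h.mixTail_eq_add hxy hy fun k hk => ?_, h.powTail_div_of_ge hx,
    h.powTail_div_of_ge (hx.trans hxy)]
  · ring
  · linarith [h.scaled_le hk, h.le_two_rpow_mul n, h.le_two_rpow_mul k, h.a_pos k]

lemma scaled_le_sub {n : ℕ} {x t : ℝ} (hx : a n ≤ x) (htx : 2 * t ≤ x) {k : ℕ} (hk : k < n) :
    2 ^ s * a k ≤ x - t := by
  linarith [h.scaled_le hk, h.le_two_rpow_mul k, h.a_pos k]

/-- The active summand is Lipschitz with constant `q n * b / a n`, which is `b * q (n + 1)`. -/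
lemma mixTail_sub_le_add {n : ℕ} {x t : ℝ} (hx : a n ≤ x) (hx' : x ≤ a (n + 1)) (ht : 0 ≤ t)
    (htx : 2 * t ≤ x) : mixTail b s a q (x - t) ≤ mixTail b s a q x + b * t * q (n + 1) := by
  rw [h.mixTail_eq_add (show x - t ≤ x by linarith) hx' fun k hk => h.scaled_le_sub hx htx hk,
    h.succ]
  have ha := h.a_pos n
  have := powTail_sub_le h.one_le_b h.one_le_s
    (div_le_div_of_nonneg_right (show x - t ≤ x by linarith) ha.le)
  have h2 := mul_le_mul_of_nonneg_left this (h.pos n).le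
  have h3 : q n * (b * (x / a n - (x - t) / a n)) = b * t * (q n / a n) := by field_simp; ring
  linarith

lemma mixTail_sub_le {x t : ℝ} (hx : a 0 ≤ x) (ht : 0 ≤ t) (htx : 2 * t ≤ x) :
    mixTail b s a q (x - t) ≤ (1 + b * t) * mixTail b s a q x := by
  obtain ⟨n, -, h1, h2⟩ := h.exists_mem_Ico hx
  have h3 := h.mixTail_sub_le_add h1 h2.le ht htx
  have h4 := mul_le_mul_of_nonneg_left (h.weight_le_mixTail h2.le)
    (mul_nonneg (by linarith [h.one_le_b]) ht : 0 ≤ b * t)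
  linarith

/-- Well before `2^s a n` the active summand alone is at least `c K q (n + 1)`, which dwarfs the
drop `b t q (n + 1)`; well after it there is no drop. -/
lemma mixTail_sub_le_off {t ε : ℝ} (ht : 0 ≤ t) (hε : 0 < ε) : ∃ K : ℝ, ∀ N : ℕ,
    ∀ᶠ x in atTop, mixTail b s a q (x - t) ≤ (1 + ε) * mixTail b s a q x ∨
      ∃ n ≥ N, |x - 2 ^ s * a n| ≤ K := by
  have hs := h.one_le_s
  have hb := h.one_le_b
  set c := (s * (2 : ℝ) ^ (s - 1))⁻¹ with hc
  have hc0 : 0 < c := by positivity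
  -- `K ≥ t` keeps `x - t` in the flat part beyond `2^s a n`; `c K ε ≥ b t` is what the part before
  -- it needs.
  set K := max t (b * t / (c * ε)) with hK
  refine ⟨K, fun N => ?_⟩
  obtain ⟨N', hNN', hN'⟩ :=
    ((eventually_ge_atTop N).and (h.tendsto_a.eventually_ge_atTop K)).exists
  filter_upwards [eventually_ge_atTop (a N'), eventually_ge_atTop (2 * t)] with x hx htx
  obtain ⟨n, hn, h1, h2⟩ := h.exists_mem_Ico hx
  have han := h.a_pos n
  have hKn : K ≤ a n := hN'.trans (h.strictMono.monotone hn)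
  have hK0 : 0 ≤ K := ht.trans (le_max_left _ _)
  by_cases hnear : |x - 2 ^ s * a n| ≤ K
  · exact Or.inr ⟨n, by omega, hnear⟩
  left
  rw [abs_le, not_and_or, not_le, not_le] at hnear
  have hpos := h.mixTail_pos x
  rcases hnear with hlow | hhigh
  · have h3 := h.mixTail_sub_le_add h1 h2.le ht htx
    have h4 : c * (K / a n) ≤ powTail b s (x / a n) :=
      le_powTail hb hs (by positivity) ((div_le_one han).2 hKn) (by
        rw [le_sub_iff_add_le, ← add_div, div_le_iff₀ han]; linarith)
    have h5 := (mul_le_mul_of_nonneg_left h4 (h.pos n).le).trans (h.term_le_mixTail n x)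
    have h6 : q n * (c * (K / a n)) = c * K * q (n + 1) := by rw [h.succ]; ring
    have h7 : b * t ≤ ε * (c * K) := by
      have := le_max_right t (b * t / (c * ε))
      rw [div_le_iff₀ (by positivity)] at this
      linarith
    have h8 := mul_le_mul_of_nonneg_right h7 (h.pos (n + 1)).le
    have h9 := mul_le_mul_of_nonneg_left h5 hε.le
    rw [h6] at h9
    linarith
  · have hKt := le_max_left t (b * t / (c * ε))
    rw [h.mixTail_flat (n := n) (x := x - t) (y := x) (by linarith) (by linarith) h2.le]
    nlinarith

/-- Terms up to `n` vanish, and later weights decay at least geometrically with ratio `1/2`, since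
every scale is at least `2`. -/
lemma mixTail_scaled_le (n : ℕ) : mixTail b s a q (2 ^ s * a n) ≤ 2 * q (n + 1) := by
  have hle : ∀ j, q (n + 1 + j) ≤ q (n + 1) * (1 / 2) ^ j := by
    intro j
    induction j with
    | zero => simp
    | succ j ih =>
      rw [← add_assoc, h.succ, pow_succ, ← mul_assoc]
      calc _ ≤ q (n + 1 + j) / 2 :=
            div_le_div_of_nonneg_left (h.pos _).le two_pos (h.two_le _)
        _ ≤ _ := by linarith
  have hzero : ∑ k ∈ Finset.range (n + 1), q k * powTail b s (2 ^ s * a n / a k) = 0 :=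
    Finset.sum_eq_zero fun k hk => by
      rw [h.powTail_div_of_ge, mul_zero]
      exact mul_le_mul_of_nonneg_left
        (h.strictMono.monotone (Nat.lt_succ_iff.1 (Finset.mem_range.1 hk))) (by positivity)
  rw [mixTail, ← (h.summable _).sum_add_tsum_nat_add (n + 1), hzero, zero_add]
  have hg : HasSum (fun j : ℕ => q (n + 1) * (1 / 2 : ℝ) ^ j) (q (n + 1) * 2) :=
    hasSum_geometric_two.mul_left _
  rw [mul_comm 2 (q (n + 1)), ← hg.tsum_eq]
  refine Summable.tsum_le_tsum (fun j => ?_) ((summable_nat_add_iff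
    (f := fun k => q k * powTail b s (2 ^ s * a n / a k)) (n + 1)).2 (h.summable _))
    hg.summable
  rw [add_comm j]
  exact (mul_le_of_le_one_right (h.pos _).le (powTail_le_one h.one_le_b h.one_le_s _)).trans (hle j)

/-- Just before `2^s a n` the drop is at least `c t q (n + 1)`, while the value there is at most `2
q (n + 1)`. This fixed relative drop keeps `F` out of `𝓛(γ)`. -/
lemma le_mixTail_scaled_sub {n : ℕ} {t : ℝ} (ht : 0 ≤ t) (htn : 2 * t ≤ a n) :
    (1 + (s * 2 ^ (s - 1))⁻¹ * t / 2) * mixTail b s a q (2 ^ s * a n) ≤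
      mixTail b s a q (2 ^ s * a n - t) := by
  have hs := h.one_le_s
  have han := h.a_pos n
  have hle := h.le_two_rpow_mul n
  set c := (s * (2 : ℝ) ^ (s - 1))⁻¹ with hc
  have hc0 : 0 < c := by positivity
  rw [h.mixTail_eq_add (n := n) (x := 2 ^ s * a n - t) (y := 2 ^ s * a n) (by linarith)
    (by linarith [h.grow n]) fun k hk => h.scaled_le_sub hle (by linarith) hk,
    h.powTail_div_of_ge le_rfl]
  have h1 : c * (t / a n) ≤ powTail b s ((2 ^ s * a n - t) / a n) :=
    le_powTail h.one_le_b hs (by positivity) ((div_le_one han).2 (by linarith)) (by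
      rw [sub_div, mul_div_cancel_right₀ _ han.ne'])
  have h2 := mul_le_mul_of_nonneg_left h1 (h.pos n).le
  have h3 : q n * (c * (t / a n)) = c * t * q (n + 1) := by rw [h.succ]; ring
  have h4 := mul_le_mul_of_nonneg_left (h.mixTail_scaled_le n) (show 0 ≤ c * t / 2 by positivity)
  linarith

end Scales

/-! ### The scales of `η` -/

/-- The weight `P(η = a_n) = C a_n^{-α}`. -/
noncomputable def etaWeight (α a : ℝ) (n : ℕ) : ℝ :=
  (∑' i, aSeq α a i ^ (-α))⁻¹ * aSeq α a n ^ (-α)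

lemma scales_aSeq {α a b s : ℝ} (hα : 1 / 2 ≤ α) (hα1 : α < 1) (hb : 1 ≤ b) (hs : 1 ≤ s)
    (ha : 1 < a) (hgrow : 2 ^ (s + 2) * a < a ^ (1 + 1 / α)) :
    Scales b s (aSeq α a) (etaWeight α a) := by
  have hα0 : 0 < α := by linarith
  have ha0 : 0 < a := by linarith
  have h2s : (2 : ℝ) ^ (s + 2) = 4 * 2 ^ s := by
    rw [Real.rpow_add two_pos]; norm_num; ring
  have hapow : 4 * 2 ^ s < a ^ (1 / α) := by
    rw [Real.rpow_add ha0, Real.rpow_one, h2s, mul_comm a] at hgrow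
    exact lt_of_mul_lt_mul_right hgrow ha0.le
  have hle : ∀ n, a ≤ aSeq α a n := fun n => by
    have : (1 : ℝ) ≤ (1 + 1 / α) ^ n := one_le_pow₀ (by linarith [show 0 < 1 / α by positivity])
    simpa [aSeq] using Real.rpow_le_rpow_of_exponent_le ha.le this
  have hpos : ∀ n, 0 < aSeq α a n := fun n => ha0.trans_le (hle n)
  -- This is where `α ≥ 1/2` enters: `a^2 ≥ a^{1/α} > 4 * 2^s ≥ 8`.
  have ha2 : 2 ≤ a := by
    have h1 : a ^ (1 / α) ≤ a ^ (2 : ℝ) :=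
      Real.rpow_le_rpow_of_exponent_le ha.le (by rw [div_le_iff₀ hα0]; linarith)
    rw [Real.rpow_two] at h1
    nlinarith [two_le_two_rpow hs]
  have hsucc : ∀ n, aSeq α a (n + 1) = aSeq α a n ^ (1 + 1 / α) := fun n => by
    rw [aSeq, aSeq, ← Real.rpow_mul ha0.le, pow_succ]
  have hg : ∀ n, 4 * (2 ^ s * aSeq α a n) ≤ aSeq α a (n + 1) := fun n => by
    rw [hsucc, Real.rpow_add (hpos n), Real.rpow_one, ← mul_assoc, mul_comm (aSeq α a n)]
    refine mul_le_mul_of_nonneg_right (hapow.le.trans ?_) (hpos n).le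
    exact Real.rpow_le_rpow ha0.le (hle n) (by positivity)
  have hpsucc : ∀ n, aSeq α a (n + 1) ^ (-α) = aSeq α a n ^ (-α) / aSeq α a n := fun n => by
    rw [hsucc, ← Real.rpow_mul (hpos n).le, ← Real.rpow_sub_one (hpos n).ne']
    congr 1; field_simp; ring
  have hppos : ∀ n, 0 < aSeq α a n ^ (-α) := fun n => Real.rpow_pos_of_pos (hpos n) _
  have hsum : Summable fun n => aSeq α a n ^ (-α) := by
    refine summable_of_ratio_norm_eventually_le (r := 1 / 2) (by norm_num)
      (Eventually.of_forall fun n => ?_)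
    rw [Real.norm_of_nonneg (hppos _).le, Real.norm_of_nonneg (hppos _).le, hpsucc]
    calc _ ≤ aSeq α a n ^ (-α) / 2 :=
          div_le_div_of_nonneg_left (hppos n).le two_pos (ha2.trans (hle n))
      _ = _ := by ring
  have hC : 0 < ∑' i, aSeq α a i ^ (-α) := hsum.tsum_pos (fun n => (hppos n).le) 0 (hppos 0)
  have htend : Tendsto (aSeq α a) atTop atTop := by
    refine tendsto_atTop_mono (fun n => ?_) tendsto_natCast_atTop_atTop
    induction n with
    | zero => simpa using (hpos 0).le
    | succ n ih =>
      push_cast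
      nlinarith [hg n, hle n, hpos n, two_le_two_rpow hs]
  refine ⟨hb, hs, fun n => ha2.trans (hle n), hg, fun n => mul_pos (inv_pos.2 hC) (hppos n),
    fun n => ?_, ?_, ?_⟩
  · rw [etaWeight, etaWeight, hpsucc, mul_div_assoc]
  · have := hsum.hasSum.mul_left (∑' i, aSeq α a i ^ (-α))⁻¹
    rwa [inv_mul_cancel₀ hC.ne'] at this
  · have h1 : ∀ n, etaWeight α a n * aSeq α a n
        = (∑' i, aSeq α a i ^ (-α))⁻¹ * aSeq α a n ^ (1 - α) := fun n => by
      rw [etaWeight, mul_assoc, ← Real.rpow_add_one (hpos n).ne', neg_add_eq_sub]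
    simp_rw [h1]
    exact ((tendsto_rpow_atTop (by linarith)).comp htend).const_mul_atTop (inv_pos.2 hC)

lemma tail_xiLaw {α a b s : ℝ} (h : Scales b s (aSeq α a) (etaWeight α a)) (x : ℝ) :
    tail (xiLaw α a b s) x = ENNReal.ofReal (mixTail b s (aSeq α a) (etaWeight α a) x) := by
  have hm : Measurable fun p : ℝ × ℝ => p.1 * (1 + p.2 ^ (1 / b)) ^ s := by fun_prop
  have : SFinite unifLaw := by rw [unifLaw]; infer_instance
  have hset : MeasurableSet ((fun p : ℝ × ℝ => p.1 * (1 + p.2 ^ (1 / b)) ^ s) ⁻¹' Ioi x) :=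
    hm measurableSet_Ioi
  rw [tail, xiLaw, Measure.map_apply hm measurableSet_Ioi, Measure.prod_apply hset, etaLaw,
    lintegral_sum_measure, mixTail,
    ENNReal.ofReal_tsum_of_nonneg (fun n => h.term_nonneg n x) (h.summable x)]
  refine tsum_congr fun n => ?_
  rw [lintegral_smul_measure, lintegral_dirac, ENNReal.ofReal_mul (h.pos n).le, smul_eq_mul,
    ← unifLaw_lt_rpow h.one_le_b h.one_le_s]
  congr 2
  ext u
  simp [div_lt_iff₀' (h.a_pos n)]

/-! ### The exponential transform -/

section ExpTransform

variable {γ : ℝ} {F₀ F : Measure ℝ} {b s : ℝ} {a q : ℕ → ℝ}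

lemma tail_expTransform (hF : IsExpTransform γ F₀ F)
    (hF₀ : ∀ x, tail F₀ x = ENNReal.ofReal (mixTail b s a q x)) {x : ℝ} (hx : 0 ≤ x) :
    tail F x = expWeight γ (-x) * ENNReal.ofReal (mixTail b s a q x) := by
  rw [hF.2, if_neg (not_lt.2 hx), hF₀, expWeight, neg_mul, mul_neg]

lemma measure_Iio_zero_of_expTransform (h : Scales b s a q) (hF : IsExpTransform γ F₀ F)
    (hF₀ : ∀ x, tail F₀ x = ENNReal.ofReal (mixTail b s a q x)) : F (Iio 0) = 0 := by
  have := hF.1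
  have h1 : tail F 0 = 1 := by
    rw [tail_expTransform hF hF₀ le_rfl, h.mixTail_of_le zero_le_two]; simp
  rw [tail, ← compl_Iic, prob_compl_eq_one_iff measurableSet_Iic] at h1
  exact measure_mono_null Iio_subset_Iic_self h1

lemma hasPositiveTails_of_expTransform (h : Scales b s a q) (hF : IsExpTransform γ F₀ F)
    (hF₀ : ∀ x, tail F₀ x = ENNReal.ofReal (mixTail b s a q x)) : HasPositiveTails F := by
  refine ⟨hF.1, fun x => ?_⟩
  rcases lt_or_ge x 0 with hx | hx
  · rw [hF.2, if_pos hx]; exact one_pos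
  · rw [tail_expTransform hF hF₀ hx]
    exact ENNReal.mul_pos (expWeight_ne_zero _ _) (ENNReal.ofReal_pos.2 (h.mixTail_pos x)).ne'

lemma expTilted_of_expTransform (h : Scales b s a q) (hF : IsExpTransform γ F₀ F)
    (hF₀ : ∀ x, tail F₀ x = ENNReal.ofReal (mixTail b s a q x)) : ExpTilted γ F := by
  intro t u ht htu
  rw [tail_expTransform hF hF₀ (ht.trans htu), tail_expTransform hF hF₀ (sub_nonneg.2 htu),
    ← mul_assoc, ← expWeight_add, neg_sub, ← sub_eq_add_neg]
  gcongr
  exact h.mixTail_antitone (by linarith)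

lemma tail_sub_le_of_mixTail_sub_le (hF : IsExpTransform γ F₀ F)
    (hF₀ : ∀ x, tail F₀ x = ENNReal.ofReal (mixTail b s a q x)) {t u c : ℝ} (hu : 0 ≤ u)
    (htu : t ≤ u) (hc : 0 ≤ c) (hm : mixTail b s a q (u - t) ≤ c * mixTail b s a q u) :
    tail F (u - t) ≤ expWeight γ t * ENNReal.ofReal c * tail F u := by
  rw [tail_expTransform hF hF₀ hu, tail_expTransform hF hF₀ (sub_nonneg.2 htu), neg_sub,
    sub_eq_add_neg t u, expWeight_add]
  calc _ ≤ expWeight γ t * expWeight γ (-u) * ENNReal.ofReal (c * mixTail b s a q u) := by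
        gcongr
    _ = _ := by rw [ENNReal.ofReal_mul hc]; ring

lemma shiftDominated_of_expTransform (h : Scales b s a q) (hF : IsExpTransform γ F₀ F)
    (hF₀ : ∀ x, tail F₀ x = ENNReal.ofReal (mixTail b s a q x)) : ShiftDominated F := by
  have := hF.1
  have hpos := hasPositiveTails_of_expTransform h hF hF₀
  intro t
  rcases le_or_gt t 0 with ht | ht
  · exact ⟨1, ENNReal.one_ne_top, fun u => by
      rw [one_mul]; exact tail_antitone F (by linarith)⟩
  -- Beyond `u₀` the mixture bound applies; below it `F̄(u) ≥ F̄(u₀) > 0` gives the first summand of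
  -- the constant.
  set u₀ := max (a 0) (2 * t) with hu₀
  refine ⟨(tail F u₀)⁻¹ + expWeight γ t * ENNReal.ofReal (1 + b * t),
    ENNReal.add_ne_top.2 ⟨ENNReal.inv_ne_top.2 (hpos.2 _).ne',
      ENNReal.mul_ne_top (expWeight_ne_top _ _) ENNReal.ofReal_ne_top⟩, fun u => ?_⟩
  rw [add_mul]
  rcases le_total u u₀ with hu | hu
  · refine le_trans ?_ le_self_add
    calc tail F (u - t) ≤ (tail F u₀)⁻¹ * tail F u₀ := by
          rw [ENNReal.inv_mul_cancel (hpos.2 _).ne' (tail_ne_top _ _)]; exact tail_le_one F _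
      _ ≤ _ := by gcongr; exact tail_antitone F hu
  · refine le_trans ?_ le_add_self
    have h1 := (le_max_left _ _).trans hu
    have h2 := (le_max_right _ _).trans hu
    exact tail_sub_le_of_mixTail_sub_le hF hF₀ ((h.a_pos 0).le.trans h1) (by linarith)
      (by nlinarith [h.one_le_b]) (h.mixTail_sub_le h1 ht.le h2)

lemma upperShiftOff_of_expTransform (h : Scales b s a q) (hF : IsExpTransform γ F₀ F)
    (hF₀ : ∀ x, tail F₀ x = ENNReal.ofReal (mixTail b s a q x)) :
    UpperShiftOff γ F fun n => 2 ^ s * a n := by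
  intro t ht c hc
  have hlim : Tendsto (fun ε : ℝ => expWeight γ t * ENNReal.ofReal (1 + ε)) (𝓝[>] 0)
      (𝓝 (expWeight γ t)) := by
    have : Tendsto (fun ε : ℝ => ENNReal.ofReal (1 + ε)) (𝓝[>] 0) (𝓝 1) := by
      have hcont : Continuous fun ε : ℝ => ENNReal.ofReal (1 + ε) :=
        ENNReal.continuous_ofReal.comp (by fun_prop)
      simpa using (hcont.tendsto 0).mono_left nhdsWithin_le_nhds
    simpa using ENNReal.Tendsto.const_mul this (Or.inr (expWeight_ne_top γ t))
  obtain ⟨ε, hεc, hε⟩ := (((tendsto_order.1 hlim).2 c hc).and self_mem_nhdsWithin).exists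
  obtain ⟨K, hK⟩ := h.mixTail_sub_le_off ht.le hε
  refine ⟨K, fun N => ?_⟩
  filter_upwards [hK N, eventually_ge_atTop t] with u hu htu
  refine hu.imp_left fun hu => (tail_sub_le_of_mixTail_sub_le hF hF₀ (ht.le.trans htu) htu
    (by linarith) hu).trans ?_
  gcongr

lemma flatAfter_of_expTransform (h : Scales b s a q) (hF : IsExpTransform γ F₀ F)
    (hF₀ : ∀ x, tail F₀ x = ENNReal.ofReal (mixTail b s a q x)) (L : ℝ) :
    ∀ᶠ n in atTop, 2 ^ s * a n + L ≤ 2 ^ s * a (n + 1) ∧ FlatAfter γ F (2 ^ s * a n) L := by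
  filter_upwards [h.tendsto_a.eventually_ge_atTop L] with n hn
  have h1 := h.grow n
  have h2 := h.le_two_rpow_mul n
  have h3 := h.le_two_rpow_mul (n + 1)
  have h4 := h.a_pos n
  refine ⟨by linarith, fun w hw0 hwL => ?_⟩
  rw [tail_expTransform hF hF₀ (by linarith), tail_expTransform hF hF₀ (by linarith),
    h.mixTail_flat le_rfl (show 2 ^ s * a n ≤ 2 ^ s * a n + w by linarith) (by linarith),
    ← mul_assoc, ← expWeight_add, neg_add_rev]

/-- Integrating over `⌊a n⌋` unit intervals gives at least a constant times `a n * G(⌊a n⌋) ≥ a n *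
q n`, which is unbounded. -/
lemma expMoment_of_expTransform (hγ : 0 < γ) (h : Scales b s a q) (hF : IsExpTransform γ F₀ F)
    (hF₀ : ∀ x, tail F₀ x = ENNReal.ofReal (mixTail b s a q x)) : expMoment γ F = ∞ := by
  have := hF.1
  have hκ := one_sub_expWeight_ne_zero hγ
  set κ := 1 - expWeight γ (-1) with hκd
  have hle : ∀ n, κ * ENNReal.ofReal (q n * a n / 2) ≤ expMoment γ F := by
    intro n
    refine le_trans ?_ ((expTilted_of_expTransform h hF hF₀).le_expMoment hγ ⌊a n⌋₊)
    have hfl : (⌊a n⌋₊ : ℝ) ≤ a n := Nat.floor_le (h.a_pos n).le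
    rw [tail_expTransform hF hF₀ (Nat.cast_nonneg _), ← mul_assoc (expWeight γ _),
      ← expWeight_add, add_neg_cancel, expWeight_zero, one_mul, mul_left_comm,
      ← ENNReal.ofReal_natCast, ← ENNReal.ofReal_mul (Nat.cast_nonneg _)]
    gcongr
    have h1 := h.weight_le_mixTail hfl
    have h2 : a n / 2 ≤ ⌊a n⌋₊ := by linarith [Nat.lt_floor_add_one (a n), h.two_le n]
    calc q n * a n / 2 = a n / 2 * q n := by ring
      _ ≤ _ := mul_le_mul h2 h1 (h.pos n).le (Nat.cast_nonneg _)
  have hlim : Tendsto (fun n => κ * ENNReal.ofReal (q n * a n / 2)) atTop (𝓝 (κ * ∞)) :=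
    ENNReal.Tendsto.const_mul (ENNReal.tendsto_ofReal_atTop.comp
      (h.tendsto.atTop_div_const two_pos)) (Or.inl ENNReal.top_ne_zero)
  rw [ENNReal.mul_top hκ] at hlim
  exact top_le_iff.1 (le_of_tendsto' hlim hle)

lemma notMem_classL_of_expTransform (h : Scales b s a q) (hF : IsExpTransform γ F₀ F)
    (hF₀ : ∀ x, tail F₀ x = ENNReal.ofReal (mixTail b s a q x)) : F ∉ classL γ := by
  intro hL
  have := hF.1
  have hs := h.one_le_s
  set d := 1 + (s * (2 : ℝ) ^ (s - 1))⁻¹ * 1 / 2 with hd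
  have hd1 : 1 < d := by
    have : 0 < (s * (2 : ℝ) ^ (s - 1))⁻¹ := by positivity
    rw [hd]; linarith
  have hc : expWeight γ 1 < expWeight γ 1 * ENNReal.ofReal d := by
    conv_lhs => rw [← mul_one (expWeight γ 1)]
    exact (ENNReal.mul_lt_mul_iff_right (expWeight_ne_zero _ _) (expWeight_ne_top _ _)).2
      (ENNReal.one_lt_ofReal.2 hd1)
  obtain ⟨c, hc1, hc2⟩ := exists_between hc
  have hβ : Tendsto (fun n => 2 ^ s * a n) atTop atTop :=
    tendsto_atTop_mono h.le_two_rpow_mul h.tendsto_a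
  obtain ⟨n, hn⟩ := (hβ.eventually (upperShift_of_mem_classL hL 1 c hc1)).exists
  have hpos := (hasPositiveTails_of_expTransform h hF hF₀).2 (2 ^ s * a n)
  have h0 : 0 ≤ 2 ^ s * a n := (h.a_pos n).le.trans (h.le_two_rpow_mul n)
  have h1 : expWeight γ 1 * ENNReal.ofReal d * tail F (2 ^ s * a n) ≤ tail F (2 ^ s * a n - 1) := by
    have hle := h.le_mixTail_scaled_sub (n := n) zero_le_one (by linarith [h.two_le n])
    rw [tail_expTransform hF hF₀ h0, tail_expTransform hF hF₀
      (by linarith [h.two_le n, h.le_two_rpow_mul n]), neg_sub, sub_eq_add_neg 1, expWeight_add]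
    calc _ = expWeight γ 1 * expWeight γ (-(2 ^ s * a n)) *
          ENNReal.ofReal (d * mixTail b s a q (2 ^ s * a n)) := by
          rw [ENNReal.ofReal_mul (by linarith)]; ring
      _ ≤ _ := by gcongr
  have h2 := h1.trans hn
  rw [ENNReal.mul_le_mul_iff_left hpos.ne' (tail_ne_top _ _)] at h2
  exact absurd hc2 (not_lt.2 h2)

lemma ShiftDominated.mem_classOL (hs : ShiftDominated F) (hF : HasPositiveTails F) :
    F ∈ classOL := by
  have := hF.1
  refine ⟨hF, fun t => ?_⟩
  obtain ⟨c, hc, h⟩ := hs t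
  refine lt_of_le_of_lt (limsup_le_of_le (by isBoundedDefault)
    (Eventually.of_forall fun x => ENNReal.div_le_of_le_mul (h x))) hc.lt_top

end ExpTransform

end ConvRoots

open ConvRoots
theorem proposition5p1 (γ : ℝ) (hγ : 0 < γ) (F : Measure ℝ) (hF : F ∈ classF1 γ) :
    LiminfCondition γ F ∧ TailLittleO F ∧ expMoment γ F = ∞ ∧
    (∀ k : ℕ, 2 ≤ k → convPow F k ∈ classL γ \ classOS) ∧
    F ∈ classOL \ (classL γ ∪ classOS) ∧
    (∀ τ : PMF ℕ, (∃ k, 2 ≤ k ∧ τ k ≠ 0) → RandomSumCondition F τ →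
      randomConv F τ ∈ classL γ \ classOS) := by
  obtain ⟨F₀, ⟨α, a, b, s, hα, hα1, hb, hs, ha, hgrow, rfl⟩, hT⟩ := hF
  have := hT.1
  have h := scales_aSeq hα hα1 hb hs ha hgrow
  have hF₀ := tail_xiLaw h
  have h0 := measure_Iio_zero_of_expTransform h hT hF₀
  have hpos := hasPositiveTails_of_expTransform h hT hF₀
  have htilt := expTilted_of_expTransform h hT hF₀
  have hdom := shiftDominated_of_expTransform h hT hF₀
  have hm := expMoment_of_expTransform hγ h hT hF₀
  have hlim := htilt.liminfCondition hpos
  have ho := tailLittleO_of_expMoment hpos hlim hm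
  have h2 := upperShift_conv_self hγ htilt hdom ho.negl (flatAfter_of_expTransform h hT hF₀)
    (upperShiftOff_of_expTransform h hT hF₀)
  refine ⟨hlim, ho, hm,
    fun k hk => convPow_mem_classL_diff_classOS hγ hpos h0 hdom ho.negl hm h2 hk,
    ⟨hdom.mem_classOL hpos, ?_⟩,
    fun τ hτ hc => randomConv_mem_classL_diff_classOS hγ hpos h0 hdom ho.negl hm h2 hτ hc⟩
  rintro (hL | hOS)
  · exact notMem_classL_of_expTransform h hT hF₀ hL
  · exact notMem_classOS hpos hlim hm hOS
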